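/- Let $\sigma:\mathbb{R}\to\mathbb{R}$ be an increasing odd homeomorphism, and let $h_\sigma,v_\sigma:\mathbb{R}^2\to\mathbb{R}^2$ be the bijections $$h_\sigma(x,y)=(x+\sigma^{-1}(y),\,y),\qquad v_\sigma(x,y)=(x,\,\sigma(x)+y).$$ Suppose that there are real numbers $a,b>0$ such that $\sigma(x)=ax$ for all $x\in[-b,b]$. Then the Lebesgue measure is the only measure $\mu$ on the Borel subsets of $\mathbb{R}_{\ge 0}^2$ such that - $\mu([0,1]^2)=1$ and $\mu(\{0\}\times\mathbb{R}_{\ge 0})=\mu(\mathbb{R}_{\ge 0}\times\{0\})=0$, and - $\mu(A)=\mu(h_\sigma(A))=\mu(v_\sigma(A))$ for all Borel subsets $A$ of $\mathbb{R}_{\ge 0}^2$. That is, the Lebesgue measure on $\mathbb{R}_{\ge 0}^2$ has these properties, and every measure with these properties is equal to it. -/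

import Mathlib

open MeasureTheory

/-- The closed positive quadrant of the plane. -/
def quadrant : Set (ℝ × ℝ) := Set.Ici 0 ×ˢ Set.Ici 0

/-- The horizontal generalized transvection `(x, y) ↦ (x + σ⁻¹(y), y)`. -/
def hTransvection (σ : ℝ ≃ₜ ℝ) (p : ℝ × ℝ) : ℝ × ℝ := (p.1 + σ.symm p.2, p.2)

/-- The vertical generalized transvection `(x, y) ↦ (x, σ(x) + y)`. -/
def vTransvection (σ : ℝ ≃ₜ ℝ) (p : ℝ × ℝ) : ℝ × ℝ := (p.1, σ p.1 + p.2)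

/-- The Lebesgue measure of the plane, as a measure on the Borel subsets of the quadrant. -/
noncomputable def quadrantLebesgue : Measure quadrant :=
  (volume : Measure (ℝ × ℝ)).comap Subtype.val

/-- The mass that a measure on the quadrant gives to a subset `A` of the quadrant,
where `A` is given as a set of points of the plane. -/
noncomputable def quadrantMass (μ : Measure quadrant) (A : Set (ℝ × ℝ)) : ENNReal :=
  μ (Subtype.val ⁻¹' A)

/-- When `σ` is increasing and odd, the horizontal transvection maps the quadrant into itself. -/
theorem hTransvection_mapsTo (σ : ℝ ≃ₜ ℝ) (hσ : StrictMono σ) (hodd : Function.Odd σ) :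
    Set.MapsTo (hTransvection σ) quadrant quadrant := by
  have h0 : σ 0 = 0 := by have := hodd 0; simp at this; linarith
  rintro ⟨x, y⟩ ⟨hx, hy⟩
  have hx' : 0 ≤ x := hx
  have hy' : 0 ≤ y := hy
  have h : 0 ≤ σ.symm y := by rw [← hσ.le_iff_le, h0]; simpa using hy'
  exact ⟨add_nonneg hx' h, hy⟩

/-- When `σ` is increasing and odd, the vertical transvection maps the quadrant into itself. -/
theorem vTransvection_mapsTo (σ : ℝ ≃ₜ ℝ) (hσ : StrictMono σ) (hodd : Function.Odd σ) :
    Set.MapsTo (vTransvection σ) quadrant quadrant := by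
  have h0 : σ 0 = 0 := by have := hodd 0; simp at this; linarith
  rintro ⟨x, y⟩ ⟨hx, hy⟩
  have hx' : 0 ≤ x := hx
  have hy' : 0 ≤ y := hy
  have h : 0 ≤ σ x := by rw [← h0]; exact hσ.monotone hx'
  exact ⟨hx, add_nonneg h hy'⟩

/-!
Lebesgue measure is invariant because both transvections are shears. For the converse, the two
transvections are viewed as the inverse branches of a subtractive Euclidean algorithm
(`euclidStep`): below the graph of `σ` it undoes the horizontal transvection, above it the vertical
one. A point at which the algorithm reaches an axis lies in the image of an axis under a word in the
two transvections, so these points are null. Every other orbit converges to the origin, hence enters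
the box where `σ` is linear. Thus an invariant measure is determined by its restriction to that box
(`eq_mul_volume_of_near_zero`), and after rescaling the vertical axis it remains to treat `σ = id`
locally (`LocallyInvariant.exists_restrict_eq`).

The main tool is a decomposition according to *last* visits. If `D` is a set visited finitely often
by each orbit, and `E` consists of the points of `D` that never return to `D`, then the images of
`E` under all words are disjoint and fill the set of points visiting `D`. Hence the part of `B` that
visits `D` has mass `∫_E #{w : w x ∈ B} dm(x)` (`LocallyInvariant.measure_inter_iUnion_word`). No
condition on the words survives, which makes the integrand a classical counting function.

Let `σ = id`. The words correspond bijectively to the coprime pairs of positive integers through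
`w ↦ w (1, 1)`, so for `x = (t, t)` the number of words with `w x ≤ (a, b)` is the number of coprime
pairs in a box with sides `a / t` and `b / t`, asymptotically a constant times `a b / t ^ 2`
(`tendsto_coprimeCount`, by Möbius inversion). By monotonicity the same holds up to a factor close
to `1` when `x` lies in a narrow cone around the diagonal. If almost every orbit visits that cone at
arbitrarily small scale, the decomposition over last visits shows that the masses of the boxes
`(0, a] × (0, b]` are proportional to `a b` (`LocallyInvariant.measure_box_mul_le`), and these boxes
determine the measure.

It remains to see that almost every orbit visits every such cone at arbitrarily small scale. For
Lebesgue measure, the set of last visits to the cone is invariant under scaling. If it had positive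
measure, the counting function, of size `|x| ^ (-2)`, would have a divergent integral over it, while
this integral is at most the area of the unit box (`volume_lastVisits_cone`,
`volume_finite_visits_cone`). For a general invariant measure, decompose over last visits to the
wide cone of ratio `2`, which every orbit visits. Comparing words with the disjoint images of a
small square bounds the number of words leading to points that avoid the narrow cone by the Lebesgue
measure of such points, so these words form a vanishing proportion of all words
(`LocallyInvariant.measure_avoiding`).
-/

/-! ### The subtractive Euclidean algorithm attached to `σ` -/

/-- The open positive quadrant of the plane. -/
def openQuadrant : Set (ℝ × ℝ) := Set.Ioi 0 ×ˢ Set.Ioi 0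

/-- The two letters: `true` acts as the horizontal transvection, `false` as the vertical one. -/
def letter (σ : ℝ ≃ₜ ℝ) : Bool → ℝ × ℝ → ℝ × ℝ
  | true => hTransvection σ
  | false => vTransvection σ

/-- The action of a word in the two transvections; the head of the list is applied last. -/
def word (σ : ℝ ≃ₜ ℝ) : List Bool → ℝ × ℝ → ℝ × ℝ
  | [], z => z
  | b :: w, z => letter σ b (word σ w z)

/-- One step of the subtractive Euclidean algorithm: undo the horizontal transvection below the
graph of `σ`, and the vertical one on and above it. -/
noncomputable def euclidStep (σ : ℝ ≃ₜ ℝ) (z : ℝ × ℝ) : ℝ × ℝ :=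
  if z.2 < σ z.1 then (z.1 - σ.symm z.2, z.2) else (z.1, z.2 - σ z.1)

/-- The points at which the subtractive algorithm never terminates, that is, never reaches
the boundary of the quadrant. -/
def nonterminating (σ : ℝ ≃ₜ ℝ) : Set (ℝ × ℝ) := {z | ∀ n, (euclidStep σ)^[n] z ∈ openQuadrant}

section Dynamics

variable {σ : ℝ ≃ₜ ℝ}

theorem mem_openQuadrant {z : ℝ × ℝ} : z ∈ openQuadrant ↔ 0 < z.1 ∧ 0 < z.2 := Iff.rfl

theorem mem_quadrant {z : ℝ × ℝ} : z ∈ quadrant ↔ 0 ≤ z.1 ∧ 0 ≤ z.2 := Iff.rfl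

theorem openQuadrant_subset_quadrant : openQuadrant ⊆ quadrant :=
  fun _ hz => ⟨Set.Ioi_subset_Ici_self hz.1, Set.Ioi_subset_Ici_self hz.2⟩

theorem measurableSet_openQuadrant : MeasurableSet openQuadrant :=
  measurableSet_Ioi.prod measurableSet_Ioi

theorem measurableSet_quadrant : MeasurableSet quadrant :=
  measurableSet_Ici.prod measurableSet_Ici

theorem apply_pos_of_pos (hσ : StrictMono σ) (h0 : σ 0 = 0) {x : ℝ} (hx : 0 < x) :
    0 < σ x := h0 ▸ hσ hx

theorem apply_nonneg_of_nonneg (hσ : StrictMono σ) (h0 : σ 0 = 0) {x : ℝ} (hx : 0 ≤ x) :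
    0 ≤ σ x := h0 ▸ hσ.monotone hx

theorem symm_pos_of_pos (hσ : StrictMono σ) (h0 : σ 0 = 0) {y : ℝ} (hy : 0 < y) : 0 < σ.symm y := by
  rw [← hσ.lt_iff_lt, h0]; simpa using hy

theorem symm_nonneg_of_nonneg (hσ : StrictMono σ) (h0 : σ 0 = 0) {y : ℝ} (hy : 0 ≤ y) :
    0 ≤ σ.symm y := by
  rw [← hσ.le_iff_le, h0]; simpa using hy

theorem le_letter (hσ : StrictMono σ) (h0 : σ 0 = 0) (b : Bool) {z : ℝ × ℝ} (hz : z ∈ quadrant) :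
    z ≤ letter σ b z := by
  cases b
  · exact ⟨le_rfl, le_add_of_nonneg_left (apply_nonneg_of_nonneg hσ h0 hz.1)⟩
  · exact ⟨le_add_of_nonneg_right (symm_nonneg_of_nonneg hσ h0 hz.2), le_rfl⟩

theorem letter_mem_quadrant (hσ : StrictMono σ) (h0 : σ 0 = 0) (b : Bool) {z : ℝ × ℝ}
    (hz : z ∈ quadrant) :
    letter σ b z ∈ quadrant :=
  have h := le_letter hσ h0 b hz
  ⟨le_trans hz.1 h.1, le_trans hz.2 h.2⟩

theorem word_mem_quadrant (hσ : StrictMono σ) (h0 : σ 0 = 0) (w : List Bool) {z : ℝ × ℝ}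
    (hz : z ∈ quadrant) :
    word σ w z ∈ quadrant := by
  induction w with
  | nil => exact hz
  | cons b w ih => exact letter_mem_quadrant hσ h0 b ih

theorem le_word (hσ : StrictMono σ) (h0 : σ 0 = 0) (w : List Bool) {z : ℝ × ℝ} (hz : z ∈ quadrant) :
    z ≤ word σ w z := by
  induction w with
  | nil => exact le_rfl
  | cons b w ih => exact ih.trans (le_letter hσ h0 b (word_mem_quadrant hσ h0 w hz))

theorem word_mem_openQuadrant (hσ : StrictMono σ) (h0 : σ 0 = 0) (w : List Bool) {z : ℝ × ℝ}
    (hz : z ∈ openQuadrant) :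
    word σ w z ∈ openQuadrant :=
  have h := le_word hσ h0 w (openQuadrant_subset_quadrant hz)
  ⟨lt_of_lt_of_le hz.1 h.1, lt_of_lt_of_le hz.2 h.2⟩

theorem euclidStep_letter (hσ : StrictMono σ) (b : Bool) {z : ℝ × ℝ} (hz : z ∈ openQuadrant) :
    euclidStep σ (letter σ b z) = z := by
  obtain ⟨x, y⟩ := z
  have hx : 0 < x := hz.1
  have hy : 0 < y := hz.2
  cases b
  · simp [euclidStep, letter, vTransvection, not_lt.2 hy.le]
  · have : y < σ (x + σ.symm y) := by
      have := hσ (show σ.symm y < x + σ.symm y by linarith)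
      simpa using this
    simp [euclidStep, letter, hTransvection, this]

theorem euclidStep_mem_quadrant (hσ : StrictMono σ) {z : ℝ × ℝ} (hz : z ∈ quadrant) :
    euclidStep σ z ∈ quadrant := by
  unfold euclidStep
  split_ifs with h
  · refine ⟨?_, hz.2⟩
    have : σ.symm z.2 ≤ z.1 := by rw [← hσ.le_iff_le]; simpa using h.le
    simpa using this
  · exact ⟨hz.1, by simpa using h⟩

theorem euclidStep_eq_or (σ : ℝ ≃ₜ ℝ) (z : ℝ × ℝ) :
    euclidStep σ z = (z.1 - σ.symm z.2, z.2) ∨ euclidStep σ z = (z.1, z.2 - σ z.1) := by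
  unfold euclidStep
  split_ifs
  · exact Or.inl rfl
  · exact Or.inr rfl

theorem exists_letter_euclidStep (σ : ℝ ≃ₜ ℝ) (z : ℝ × ℝ) :
    ∃ b, letter σ b (euclidStep σ z) = z := by
  unfold euclidStep
  split_ifs
  · exact ⟨true, by simp [letter, hTransvection]⟩
  · exact ⟨false, by simp [letter, vTransvection]⟩

theorem exists_word_iterate (σ : ℝ ≃ₜ ℝ) (n : ℕ) (z : ℝ × ℝ) :
    ∃ w : List Bool, w.length = n ∧ word σ w ((euclidStep σ)^[n] z) = z := by
  induction n generalizing z with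
  | zero => exact ⟨[], rfl, rfl⟩
  | succ n ih =>
    obtain ⟨w, hw, hwz⟩ := ih (euclidStep σ z)
    obtain ⟨b, hb⟩ := exists_letter_euclidStep σ z
    exact ⟨b :: w, by simp [hw], by rw [Function.iterate_succ_apply, word, hwz, hb]⟩

theorem iterate_word_append (hσ : StrictMono σ) (h0 : σ 0 = 0) (u w : List Bool) {z : ℝ × ℝ}
    (hz : z ∈ openQuadrant) :
    (euclidStep σ)^[u.length] (word σ (u ++ w) z) = word σ w z := by
  induction u with
  | nil => rfl
  | cons b u ih =>
    rw [List.length_cons, Function.iterate_succ_apply, List.cons_append, word,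
      euclidStep_letter hσ b (word_mem_openQuadrant hσ h0 _ hz), ih]

theorem iterate_word (hσ : StrictMono σ) (h0 : σ 0 = 0) (w : List Bool) {z : ℝ × ℝ}
    (hz : z ∈ openQuadrant) :
    (euclidStep σ)^[w.length] (word σ w z) = z := by
  simpa [word] using iterate_word_append hσ h0 w [] hz

theorem letter_injective_left (hσ : StrictMono σ) (h0 : σ 0 = 0) {b b' : Bool} {z z' : ℝ × ℝ}
    (hz : z ∈ openQuadrant)
    (hz' : z' ∈ openQuadrant) (h : letter σ b z = letter σ b' z') : b = b' := by
  have hzz : z = z' := by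
    rw [← euclidStep_letter hσ b hz, h, euclidStep_letter hσ b' hz']
  subst hzz
  have h1 := apply_pos_of_pos hσ h0 hz.1
  have h2 := symm_pos_of_pos hσ h0 hz.2
  cases b <;> cases b' <;>
    simp [letter, hTransvection, vTransvection] at h ⊢ <;> linarith [h.1, h.2]

/-- The images of the open quadrant under two words are nested or disjoint: if `w` is not longer
than `w'` and the images share a point, then `w` is an initial segment of `w'`. -/
theorem word_eq_word (hσ : StrictMono σ) (h0 : σ 0 = 0) {w w' : List Bool}
    (hlen : w.length ≤ w'.length) {z z' : ℝ × ℝ}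
    (hz : z ∈ openQuadrant) (hz' : z' ∈ openQuadrant) (h : word σ w z = word σ w' z') :
    ∃ u, w' = w ++ u ∧ z = word σ u z' := by
  induction w generalizing w' with
  | nil => exact ⟨w', rfl, h⟩
  | cons b w ih =>
    cases w' with
    | nil => simp at hlen
    | cons b' w' =>
      have hw := word_mem_openQuadrant hσ h0 w hz
      have hw' := word_mem_openQuadrant hσ h0 w' hz'
      have hb : b = b' := letter_injective_left hσ h0 hw hw' h
      have he : word σ w z = word σ w' z' := by
        rw [← euclidStep_letter hσ b hw, ← euclidStep_letter hσ b' hw']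
        exact congrArg _ h
      obtain ⟨u, hu, hzu⟩ := ih (by simpa using hlen) he
      exact ⟨u, by rw [hb, hu]; rfl, hzu⟩

theorem nonterminating_subset : nonterminating σ ⊆ openQuadrant := fun _ hz => hz 0

theorem iterate_mem_nonterminating {z : ℝ × ℝ} (hz : z ∈ nonterminating σ) (n : ℕ) :
    (euclidStep σ)^[n] z ∈ nonterminating σ := fun m => by
  rw [← Function.iterate_add_apply]; exact hz _

theorem word_mem_nonterminating (hσ : StrictMono σ) (h0 : σ 0 = 0) (w : List Bool) {z : ℝ × ℝ}
    (hz : z ∈ nonterminating σ) :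
    word σ w z ∈ nonterminating σ := by
  induction w with
  | nil => exact hz
  | cons b w ih =>
    intro n
    cases n with
    | zero => exact word_mem_openQuadrant hσ h0 (b :: w) (hz 0)
    | succ n =>
      rw [Function.iterate_succ_apply, word, euclidStep_letter hσ b (nonterminating_subset ih)]
      exact ih n

theorem euclidStep_le (hσ : StrictMono σ) (h0 : σ 0 = 0) {z : ℝ × ℝ} (hz : z ∈ quadrant) :
    euclidStep σ z ≤ z := by
  obtain ⟨b, hb⟩ := exists_letter_euclidStep σ z
  conv_rhs => rw [← hb]
  exact le_letter hσ h0 b (euclidStep_mem_quadrant hσ hz)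

theorem iterate_antitone (hσ : StrictMono σ) (h0 : σ 0 = 0) {z : ℝ × ℝ} (hz : z ∈ nonterminating σ)
    :
    Antitone fun n => (euclidStep σ)^[n] z :=
  antitone_nat_of_succ_le fun n => by
    rw [Function.iterate_succ_apply']
    exact euclidStep_le hσ h0 (openQuadrant_subset_quadrant (hz n))

/-- Along a nonterminating orbit the abscissa tends to `0`: while it stays above `c`, each
vertical step lowers the ordinate by at least `σ c`, and horizontal steps cannot go on forever. -/
theorem exists_iterate_fst_lt (hσ : StrictMono σ) (h0 : σ 0 = 0) {z : ℝ × ℝ}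
    (hz : z ∈ nonterminating σ) {c : ℝ} (hc : 0 < c) :
    ∃ n, ((euclidStep σ)^[n] z).1 < c := by
  by_contra! hcon
  have hσc := apply_pos_of_pos hσ h0 hc
  -- a later vertical step exists, otherwise the abscissa would decrease linearly forever
  have key : ∀ n, ∃ m, ((euclidStep σ)^[m] z).2 ≤ ((euclidStep σ)^[n] z).2 - σ c := by
    intro n
    by_contra! hn
    have hy := (hz n).2
    set y := ((euclidStep σ)^[n] z).2 with hydef
    have hs := symm_pos_of_pos hσ h0 hy
    have hrun : ∀ k : ℕ, ((euclidStep σ)^[n + k] z).2 = y ∧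
        ((euclidStep σ)^[n + k] z).1 = ((euclidStep σ)^[n] z).1 - k * σ.symm y := by
      intro k
      induction k with
      | zero => simp [hydef]
      | succ k ih =>
        have h1 := hn (n + k + 1)
        rw [← add_assoc]
        rw [Function.iterate_succ_apply'] at h1 ⊢
        rcases euclidStep_eq_or σ ((euclidStep σ)^[n + k] z) with h | h
        · rw [h]
          refine ⟨ih.1, ?_⟩
          rw [ih.1, ih.2]; push_cast; ring
        · have h2 := hσ.monotone (hcon (n + k))
          rw [h, ih.1] at h1
          simp only at h1
          linarith
    obtain ⟨k, hk⟩ := exists_nat_gt (((euclidStep σ)^[n] z).1 / σ.symm y)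
    rw [div_lt_iff₀ hs] at hk
    have := (hz (n + k)).1
    have h2 := (hrun k).2
    have h3 : (0 : ℝ) < ((euclidStep σ)^[n + k] z).1 := this
    linarith
  have key2 : ∀ k : ℕ, ∃ m, ((euclidStep σ)^[m] z).2 ≤ z.2 - k * σ c := by
    intro k
    induction k with
    | zero => exact ⟨0, by simp⟩
    | succ k ih =>
      obtain ⟨m, hm⟩ := ih
      obtain ⟨m', hm'⟩ := key m
      exact ⟨m', by push_cast; linarith⟩
  obtain ⟨k, hk⟩ := exists_nat_gt (z.2 / σ c)
  rw [div_lt_iff₀ hσc] at hk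
  obtain ⟨m, hm⟩ := key2 k
  have h3 : (0 : ℝ) < ((euclidStep σ)^[m] z).2 := (hz m).2
  linarith

/-- The ordinate tends to `0` as well, by the symmetric argument. -/
theorem exists_iterate_snd_lt (hσ : StrictMono σ) (h0 : σ 0 = 0) {z : ℝ × ℝ}
    (hz : z ∈ nonterminating σ) {c : ℝ} (hc : 0 < c) :
    ∃ n, ((euclidStep σ)^[n] z).2 < c := by
  by_contra! hcon
  have hσc := symm_pos_of_pos hσ h0 hc
  have hmono : Monotone σ.symm := fun a b hab => by rw [← hσ.le_iff_le]; simpa using hab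
  have key : ∀ n, ∃ m, ((euclidStep σ)^[m] z).1 ≤ ((euclidStep σ)^[n] z).1 - σ.symm c := by
    intro n
    by_contra! hn
    have hx := (hz n).1
    set x := ((euclidStep σ)^[n] z).1 with hxdef
    have hs := apply_pos_of_pos hσ h0 hx
    have hrun : ∀ k : ℕ, ((euclidStep σ)^[n + k] z).1 = x ∧
        ((euclidStep σ)^[n + k] z).2 = ((euclidStep σ)^[n] z).2 - k * σ x := by
      intro k
      induction k with
      | zero => simp [hxdef]
      | succ k ih =>
        have h1 := hn (n + k + 1)
        rw [← add_assoc]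
        rw [Function.iterate_succ_apply'] at h1 ⊢
        rcases euclidStep_eq_or σ ((euclidStep σ)^[n + k] z) with h | h
        · have h2 := hmono (hcon (n + k))
          rw [h, ih.1] at h1
          simp only at h1
          linarith
        · rw [h]
          refine ⟨ih.1, ?_⟩
          rw [ih.1, ih.2]; push_cast; ring
    obtain ⟨k, hk⟩ := exists_nat_gt (((euclidStep σ)^[n] z).2 / σ x)
    rw [div_lt_iff₀ hs] at hk
    have h2 := (hrun k).2
    have h3 : (0 : ℝ) < ((euclidStep σ)^[n + k] z).2 := (hz (n + k)).2
    linarith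
  have key2 : ∀ k : ℕ, ∃ m, ((euclidStep σ)^[m] z).1 ≤ z.1 - k * σ.symm c := by
    intro k
    induction k with
    | zero => exact ⟨0, by simp⟩
    | succ k ih =>
      obtain ⟨m, hm⟩ := ih
      obtain ⟨m', hm'⟩ := key m
      exact ⟨m', by push_cast; linarith⟩
  obtain ⟨k, hk⟩ := exists_nat_gt (z.1 / σ.symm c)
  rw [div_lt_iff₀ hσc] at hk
  obtain ⟨m, hm⟩ := key2 k
  have h3 : (0 : ℝ) < ((euclidStep σ)^[m] z).1 := (hz m).1
  linarith

end Dynamics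

/-! ### Invariant measures and the decomposition along sections -/

/-- Invariance of a measure under the two transvections, as long as the image set stays inside
the region `R`. -/
def LocallyInvariant (σ : ℝ ≃ₜ ℝ) (m : Measure (ℝ × ℝ)) (R : Set (ℝ × ℝ)) : Prop :=
  ∀ b A, MeasurableSet A → A ⊆ quadrant → letter σ b '' A ⊆ R → m (letter σ b '' A) = m A

/-- A set whose images under the words are pairwise disjoint, see
`IsSection.pairwise_disjoint`. -/
structure IsSection (σ : ℝ ≃ₜ ℝ) (E : Set (ℝ × ℝ)) : Prop where
  subset : E ⊆ openQuadrant
  word_notMem : ∀ u, u ≠ [] → ∀ x ∈ E, word σ u x ∉ E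

/-- The nonterminating points of `D` whose later iterates all avoid `D`. -/
def lastVisits (σ : ℝ ≃ₜ ℝ) (D : Set (ℝ × ℝ)) : Set (ℝ × ℝ) :=
  {x | x ∈ nonterminating σ ∧ x ∈ D ∧ ∀ n, (euclidStep σ)^[n + 1] x ∉ D}

/-- The number of words that send `x` into `B`. -/
noncomputable def orbitCount (σ : ℝ ≃ₜ ℝ) (B : Set (ℝ × ℝ)) (x : ℝ × ℝ) : ENNReal :=
  ∑' w : List Bool, B.indicator 1 (word σ w x)

section Measure

variable {σ : ℝ ≃ₜ ℝ}

theorem continuous_letter (σ : ℝ ≃ₜ ℝ) (b : Bool) : Continuous (letter σ b) := by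
  cases b
  · exact continuous_fst.prodMk ((σ.continuous.comp continuous_fst).add continuous_snd)
  · exact (continuous_fst.add (σ.symm.continuous.comp continuous_snd)).prodMk continuous_snd

theorem injective_letter (σ : ℝ ≃ₜ ℝ) (b : Bool) : Function.Injective (letter σ b) := by
  rintro ⟨x, y⟩ ⟨x', y'⟩ h
  cases b <;> simp only [letter, hTransvection, vTransvection, Prod.mk.injEq] at h ⊢
  · obtain ⟨rfl, h⟩ := h
    exact ⟨rfl, by linarith⟩
  · obtain ⟨h, rfl⟩ := h
    exact ⟨by linarith, rfl⟩

theorem continuous_word (σ : ℝ ≃ₜ ℝ) (w : List Bool) : Continuous (word σ w) := by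
  induction w with
  | nil => exact continuous_id
  | cons b w ih => exact (continuous_letter σ b).comp ih

theorem injective_word (σ : ℝ ≃ₜ ℝ) (w : List Bool) : Function.Injective (word σ w) := by
  induction w with
  | nil => exact fun _ _ h => h
  | cons b w ih => exact (injective_letter σ b).comp ih

theorem measurableEmbedding_letter (σ : ℝ ≃ₜ ℝ) (b : Bool) : MeasurableEmbedding (letter σ b) :=
  (continuous_letter σ b).measurableEmbedding (injective_letter σ b)

theorem measurableEmbedding_word (σ : ℝ ≃ₜ ℝ) (w : List Bool) : MeasurableEmbedding (word σ w) :=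
  (continuous_word σ w).measurableEmbedding (injective_word σ w)

theorem measurable_euclidStep (σ : ℝ ≃ₜ ℝ) : Measurable (euclidStep σ) := by
  have h1 : Measurable fun z : ℝ × ℝ => σ z.1 := σ.continuous.measurable.comp measurable_fst
  have h2 : Measurable fun z : ℝ × ℝ => σ.symm z.2 :=
    σ.symm.continuous.measurable.comp measurable_snd
  exact Measurable.ite (measurableSet_lt measurable_snd h1)
    ((measurable_fst.sub h2).prodMk measurable_snd) (measurable_fst.prodMk (measurable_snd.sub h1))

theorem measurable_iterate_euclidStep (σ : ℝ ≃ₜ ℝ) (n : ℕ) : Measurable (euclidStep σ)^[n] :=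
  (measurable_euclidStep σ).iterate n

theorem measurableSet_nonterminating (σ : ℝ ≃ₜ ℝ) : MeasurableSet (nonterminating σ) := by
  have : nonterminating σ = ⋂ n, (euclidStep σ)^[n] ⁻¹' openQuadrant := by
    ext; simp [nonterminating]
  rw [this]
  exact .iInter fun n => measurable_iterate_euclidStep σ n measurableSet_openQuadrant

theorem measurableSet_lastVisits (σ : ℝ ≃ₜ ℝ) {D : Set (ℝ × ℝ)} (hD : MeasurableSet D) :
    MeasurableSet (lastVisits σ D) := by
  have : lastVisits σ D =
      nonterminating σ ∩ (D ∩ ⋂ n, ((euclidStep σ)^[n + 1] ⁻¹' D)ᶜ) := by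
    ext; simp [lastVisits]; tauto
  rw [this]
  exact (measurableSet_nonterminating σ).inter (hD.inter (.iInter fun n =>
    (measurable_iterate_euclidStep σ _ hD).compl))

theorem LocallyInvariant.measure_image_word (hσ : StrictMono σ) (h0 : σ 0 = 0)
    {m : Measure (ℝ × ℝ)} {R : Set (ℝ × ℝ)} (hm : LocallyInvariant σ m R) (hR : IsLowerSet R)
    (w : List Bool) {A : Set (ℝ × ℝ)} (hA : MeasurableSet A) (hAQ : A ⊆ quadrant)
    (hwA : word σ w '' A ⊆ R) : m (word σ w '' A) = m A := by
  induction w with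
  | nil => simp [word]
  | cons b w ih =>
    have himg : word σ (b :: w) '' A = letter σ b '' (word σ w '' A) := by
      rw [Set.image_image]; rfl
    have hQ : word σ w '' A ⊆ quadrant := by
      rintro _ ⟨x, hx, rfl⟩
      exact word_mem_quadrant hσ h0 w (hAQ hx)
    rw [himg] at hwA ⊢
    rw [hm b _ ((measurableEmbedding_word σ w).measurableSet_image.2 hA) hQ hwA]
    refine ih fun x hx => hR (le_letter hσ h0 b (hQ hx)) (hwA ⟨x, hx, rfl⟩)

/-- If the axes are null, then almost every point is nonterminating: a terminating point lies in
the image of an axis under some word. -/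
theorem LocallyInvariant.measure_diff_nonterminating (hσ : StrictMono σ) (h0 : σ 0 = 0)
    {m : Measure (ℝ × ℝ)} {R : Set (ℝ × ℝ)} (hm : LocallyInvariant σ m R) (hR : IsLowerSet R)
    (hRm : MeasurableSet R) (hax : m (quadrant \ openQuadrant) = 0) :
    m ((R ∩ quadrant) \ nonterminating σ) = 0 := by
  have hsub : (R ∩ quadrant) \ nonterminating σ ⊆
      ⋃ w : List Bool, word σ w '' ((quadrant \ openQuadrant) ∩ word σ w ⁻¹' R) := by
    rintro z ⟨⟨hzR, hzQ⟩, hz⟩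
    obtain ⟨n, hn⟩ : ∃ n, (euclidStep σ)^[n] z ∉ openQuadrant := by
      simpa [nonterminating] using hz
    have hnQ : (euclidStep σ)^[n] z ∈ quadrant := by
      clear hn
      induction n with
      | zero => exact hzQ
      | succ n ih =>
        rw [Function.iterate_succ_apply']
        exact euclidStep_mem_quadrant hσ ih
    obtain ⟨w, -, hw⟩ := exists_word_iterate σ n z
    exact Set.mem_iUnion.2 ⟨w, _, ⟨⟨hnQ, hn⟩, by simpa [hw] using hzR⟩, hw⟩
  refine measure_mono_null hsub (measure_iUnion_null fun w => ?_)
  rw [hm.measure_image_word hσ h0 hR]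
  · exact measure_mono_null Set.inter_subset_left hax
  · exact (measurableSet_quadrant.diff measurableSet_openQuadrant).inter
      ((measurableEmbedding_word σ w).measurable hRm)
  · exact fun x hx => hx.1.1
  · rintro _ ⟨x, hx, rfl⟩
    exact hx.2

theorem IsSection.pairwise_disjoint (hσ : StrictMono σ) (h0 : σ 0 = 0) {E : Set (ℝ × ℝ)}
    (hE : IsSection σ E) : Pairwise (Function.onFun Disjoint fun w => word σ w '' E) := by
  have key : ∀ w w' : List Bool, w ≠ w' → w.length ≤ w'.length →
      Disjoint (word σ w '' E) (word σ w' '' E) := by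
    intro w w' hne hlen
    rw [Set.disjoint_left]
    rintro _ ⟨x, hx, rfl⟩ ⟨x', hx', h⟩
    obtain ⟨u, rfl, hu⟩ := word_eq_word hσ h0 hlen (hE.subset hx) (hE.subset hx') h.symm
    refine hE.word_notMem u ?_ x' hx' (hu ▸ hx)
    rintro rfl
    simp at hne
  intro w w' hne
  rcases le_total w.length w'.length with h | h
  · exact key w w' hne h
  · exact (key w' w hne.symm h).symm

theorem isSection_lastVisits (hσ : StrictMono σ) (h0 : σ 0 = 0) (D : Set (ℝ × ℝ)) :
    IsSection σ (lastVisits σ D) where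
  subset _ hx := nonterminating_subset hx.1
  word_notMem u hu x hx hux := by
    obtain ⟨n, hn⟩ := Nat.exists_eq_succ_of_ne_zero (mt List.length_eq_zero_iff.1 hu)
    apply hux.2.2 n
    have := iterate_word hσ h0 u (nonterminating_subset hx.1)
    rw [hn] at this
    rw [this]
    exact hx.2.1

/-- A point with a visit to `D`, but only finitely many, is the image of its last visit. -/
theorem mem_iUnion_word_lastVisits {D : Set (ℝ × ℝ)} {z : ℝ × ℝ} (hz : z ∈ nonterminating σ)
    (h1 : ∃ n, (euclidStep σ)^[n] z ∈ D) (h2 : ∃ N, ∀ n, N ≤ n → (euclidStep σ)^[n] z ∉ D) :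
    z ∈ ⋃ w, word σ w '' lastVisits σ D := by
  classical
  obtain ⟨N, hN⟩ := h2
  obtain ⟨n, hn⟩ := h1
  set k := Nat.findGreatest (fun i => (euclidStep σ)^[i] z ∈ D) N with hk
  have hnN : n ≤ N := by
    by_contra h
    exact hN n (by omega) hn
  have hkD : (euclidStep σ)^[k] z ∈ D :=
    Nat.findGreatest_spec (P := fun i => (euclidStep σ)^[i] z ∈ D) hnN hn
  obtain ⟨w, -, hw⟩ := exists_word_iterate σ k z
  refine Set.mem_iUnion.2 ⟨w, _, ⟨iterate_mem_nonterminating hz k, hkD, fun j hj => ?_⟩, hw⟩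
  rw [← Function.iterate_add_apply] at hj
  by_cases hle : j + 1 + k ≤ N
  · have := Nat.le_findGreatest (P := fun i => (euclidStep σ)^[i] z ∈ D) hle hj
    omega
  · exact hN _ (by omega) hj

/-- Decomposing the mass of `B` along the images of a section: every point of `B` over the section
is counted once, through its base point. -/
theorem LocallyInvariant.measure_inter_iUnion_word (hσ : StrictMono σ) (h0 : σ 0 = 0)
    {m : Measure (ℝ × ℝ)} {R : Set (ℝ × ℝ)} (hm : LocallyInvariant σ m R) (hR : IsLowerSet R)
    {E B : Set (ℝ × ℝ)} (hE : IsSection σ E) (hEm : MeasurableSet E) (hB : MeasurableSet B)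
    (hBR : B ⊆ R) :
    m (B ∩ ⋃ w, word σ w '' E) = ∫⁻ x in E, orbitCount σ B x ∂m := by
  have hpre : ∀ w, MeasurableSet (word σ w ⁻¹' B) := fun w =>
    (measurableEmbedding_word σ w).measurable hB
  have hset : B ∩ ⋃ w, word σ w '' E = ⋃ w, word σ w '' (E ∩ word σ w ⁻¹' B) := by
    rw [Set.inter_iUnion]
    refine Set.iUnion_congr fun w => ?_
    rw [Set.image_inter_preimage, Set.inter_comm]
  rw [hset, measure_iUnion]
  · unfold orbitCount
    rw [lintegral_tsum]
    · refine tsum_congr fun w => ?_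
      have : (fun x => B.indicator (1 : ℝ × ℝ → ENNReal) (word σ w x)) =
          (word σ w ⁻¹' B).indicator 1 := rfl
      rw [this, lintegral_indicator_one (hpre w), Measure.restrict_apply (hpre w),
        hm.measure_image_word hσ h0 hR w (hEm.inter (hpre w)), Set.inter_comm]
      · exact fun x hx => openQuadrant_subset_quadrant (hE.subset hx.1)
      · rintro _ ⟨x, hx, rfl⟩
        exact hBR hx.2
    · exact fun w => ((measurable_one.indicator hB).comp
        (measurableEmbedding_word σ w).measurable).aemeasurable
  · exact fun w w' hne => (hE.pairwise_disjoint hσ h0 hne).mono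
      (Set.image_mono Set.inter_subset_left) (Set.image_mono Set.inter_subset_left)
  · exact fun w => (measurableEmbedding_word σ w).measurableSet_image.2 (hEm.inter (hpre w))

theorem measurePreserving_letter (σ : ℝ ≃ₜ ℝ) (b : Bool) :
    MeasurePreserving (letter σ b) (volume : Measure (ℝ × ℝ)) volume := by
  have key : ∀ f : ℝ → ℝ, Continuous f →
      MeasurePreserving (fun z : ℝ × ℝ => (z.1, f z.1 + z.2)) volume volume := by
    intro f hf
    rw [Measure.volume_eq_prod]
    refine (MeasurePreserving.id (volume : Measure ℝ)).skew_product
      (g := fun x y => f x + y) ?_ ?_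
    · exact (hf.measurable.comp measurable_fst).add measurable_snd
    · exact Filter.Eventually.of_forall fun x => map_add_left_eq_self volume (f x)
  cases b
  · exact key σ σ.continuous
  · have hswap : MeasurePreserving (Prod.swap : ℝ × ℝ → ℝ × ℝ) volume volume := by
      rw [Measure.volume_eq_prod]
      exact Measure.measurePreserving_swap
    convert hswap.comp ((key σ.symm σ.symm.continuous).comp hswap) using 1
    ext z <;> simp [letter, hTransvection, add_comm]

theorem locallyInvariant_volume (σ : ℝ ≃ₜ ℝ) (R : Set (ℝ × ℝ)) :
    LocallyInvariant σ volume R := by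
  intro b A hA _ _
  rw [← (measurePreserving_letter σ b).measure_preimage
    ((measurableEmbedding_letter σ b).measurableSet_image.2 hA).nullMeasurableSet,
    (injective_letter σ b).preimage_image]

theorem volume_axes : volume (quadrant \ openQuadrant) = 0 := by
  have h1 : volume (({0} : Set ℝ) ×ˢ (Set.univ : Set ℝ)) = 0 := by
    rw [Measure.volume_eq_prod, Measure.prod_prod]; simp
  have h2 : volume ((Set.univ : Set ℝ) ×ˢ ({0} : Set ℝ)) = 0 := by
    rw [Measure.volume_eq_prod, Measure.prod_prod]; simp
  refine measure_mono_null ?_ (measure_union_null h1 h2)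
  rintro z ⟨⟨hx, hy⟩, hz⟩
  have hx : 0 ≤ z.1 := hx
  have hy : 0 ≤ z.2 := hy
  rcases hx.eq_or_lt with h | h
  · exact Or.inl ⟨h.symm, trivial⟩
  · rcases hy.eq_or_lt with h' | h'
    · exact Or.inr ⟨trivial, h'.symm⟩
    · exact absurd (show z ∈ openQuadrant from ⟨h, h'⟩) hz

end Measure

/-! ### Counting coprime pairs -/

/-- The number of coprime pairs `(p, q)` with `1 ≤ p ≤ m` and `1 ≤ q ≤ n`. -/
def coprimeCount (m n : ℕ) : ℕ :=
  ((Finset.Ioc 0 m ×ˢ Finset.Ioc 0 n).filter fun p => Nat.Coprime p.1 p.2).card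

section Coprime

open Filter Topology
open ArithmeticFunction (moebius)

/-- Möbius inversion for the number of coprime pairs. -/
theorem coprimeCount_eq_sum (m n : ℕ) :
    (coprimeCount m n : ℤ) = ∑ d ∈ Finset.Ioc 0 m, moebius d * ((m / d : ℕ) * (n / d : ℕ)) := by
  have hind : ∀ p ∈ Finset.Ioc 0 m ×ˢ Finset.Ioc 0 n,
      (if Nat.Coprime p.1 p.2 then (1 : ℤ) else 0) =
        ∑ d ∈ Finset.Ioc 0 m, if d ∣ p.1 ∧ d ∣ p.2 then moebius d else 0 := by
    rintro ⟨p, q⟩ hpq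
    simp only [Finset.mem_product, Finset.mem_Ioc] at hpq
    rw [← Finset.sum_filter]
    have hdiv : (Finset.Ioc 0 m).filter (fun d => d ∣ p ∧ d ∣ q) = (Nat.gcd p q).divisors := by
      ext d
      simp only [Finset.mem_filter, Finset.mem_Ioc, Nat.mem_divisors, Nat.dvd_gcd_iff, ne_eq,
        Nat.gcd_eq_zero_iff]
      constructor
      · rintro ⟨-, h⟩
        exact ⟨h, by omega⟩
      · rintro ⟨h, -⟩
        have := Nat.le_of_dvd hpq.1.1 h.1
        exact ⟨⟨Nat.pos_of_dvd_of_pos h.1 hpq.1.1, by omega⟩, h⟩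
    rw [hdiv, ← ArithmeticFunction.coe_mul_zeta_apply, ArithmeticFunction.moebius_mul_coe_zeta,
      ArithmeticFunction.one_apply]
  rw [coprimeCount, Finset.card_filter]
  push_cast
  rw [Finset.sum_congr rfl hind, Finset.sum_comm]
  refine Finset.sum_congr rfl fun d _ => ?_
  rw [← Finset.sum_filter, Finset.sum_const, Finset.filter_product, Finset.card_product,
    Nat.Ioc_filter_dvd_card_eq_div, Nat.Ioc_filter_dvd_card_eq_div, nsmul_eq_mul]
  push_cast
  ring

theorem coprimeCount_eq_tsum (m n : ℕ) :
    (coprimeCount m n : ℝ) = ∑' d : ℕ, (moebius d : ℝ) * ((m / d : ℕ) * (n / d : ℕ)) := by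
  rw [tsum_eq_sum (s := Finset.Ioc 0 m)]
  · have h := congrArg (Int.cast : ℤ → ℝ) (coprimeCount_eq_sum m n)
    push_cast at h ⊢
    exact h
  · intro d hd
    rcases Nat.eq_zero_or_pos d with rfl | hpos
    · simp
    · have : m < d := by simpa [hpos] using hd
      simp [Nat.div_eq_of_lt this]

theorem abs_moebius_le_one_real (d : ℕ) : |(moebius d : ℝ)| ≤ 1 := by
  exact_mod_cast ArithmeticFunction.abs_moebius_le_one (n := d)

theorem summable_one_div_sq : Summable fun d : ℕ => (1 : ℝ) / (d : ℝ) ^ 2 :=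
  hasSum_zeta_two.summable

/-- The density of coprime pairs (equal to `6 / π ^ 2`). -/
noncomputable def coprimeDensity : ℝ := ∑' d : ℕ, (moebius d : ℝ) / (d : ℝ) ^ 2

theorem coprimeDensity_pos : 0 < coprimeDensity := by
  have hnorm : ∀ d : ℕ, ‖(moebius d : ℝ) / (d : ℝ) ^ 2‖ ≤ 1 / (d : ℝ) ^ 2 := by
    intro d
    rw [norm_div, Real.norm_eq_abs, norm_pow, Real.norm_natCast]
    gcongr
    exact abs_moebius_le_one_real d
  have hsum : Summable fun d : ℕ => (moebius d : ℝ) / (d : ℝ) ^ 2 :=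
    Summable.of_norm_bounded summable_one_div_sq hnorm
  -- Only the term `d = 1` is used: `∑ μ(d) / d ^ 2 ≥ 2 - ∑ 1 / d ^ 2 = 2 - π ^ 2 / 6 > 0`.
  have hadd : HasSum (fun d : ℕ => (moebius d : ℝ) / (d : ℝ) ^ 2 + 1 / (d : ℝ) ^ 2)
      (coprimeDensity + Real.pi ^ 2 / 6) := hsum.hasSum.add hasSum_zeta_two
  have h2 : 2 ≤ coprimeDensity + Real.pi ^ 2 / 6 := by
    have := le_hasSum hadd 1 fun d _ => by
      have := neg_le_of_abs_le (hnorm d)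
      linarith
    norm_num at this
    linarith
  have hpi := Real.pi_lt_d2
  have hpi0 := Real.pi_pos
  nlinarith

theorem tendsto_coprimeCount {a b : ℝ} (ha : 0 ≤ a) (hb : 0 ≤ b) :
    Tendsto (fun r : ℝ => (coprimeCount ⌊a * r⌋₊ ⌊b * r⌋₊ : ℝ) / r ^ 2) atTop
      (𝓝 (coprimeDensity * (a * b))) := by
  have hfloor : ∀ {c : ℝ}, 0 ≤ c → ∀ d : ℕ,
      Tendsto (fun r : ℝ => ((⌊c * r⌋₊ / d : ℕ) : ℝ) / r) atTop (𝓝 (c / d)) := by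
    intro c hc d
    refine (tendsto_nat_floor_mul_div_atTop (div_nonneg hc d.cast_nonneg)).congr fun r => ?_
    rw [← Nat.floor_div_natCast]
    congr 3
    ring
  have hle : ∀ {c : ℝ}, 0 ≤ c → ∀ (d : ℕ) {r : ℝ}, 0 < r →
      ((⌊c * r⌋₊ / d : ℕ) : ℝ) / r ≤ c / d := by
    intro c hc d r hr
    rw [div_le_iff₀ hr]
    refine Nat.cast_div_le.trans ?_
    rw [div_mul_eq_mul_div]
    gcongr
    exact Nat.floor_le (by positivity)
  have hlim : coprimeDensity * (a * b) =
      ∑' d : ℕ, (moebius d : ℝ) * (a / d * (b / d)) := by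
    rw [coprimeDensity, ← tsum_mul_right]
    refine tsum_congr fun d => ?_
    ring
  rw [hlim]
  have hfun : (fun r : ℝ => (coprimeCount ⌊a * r⌋₊ ⌊b * r⌋₊ : ℝ) / r ^ 2) = fun r =>
      ∑' d : ℕ, (moebius d : ℝ) *
        (((⌊a * r⌋₊ / d : ℕ) : ℝ) / r * (((⌊b * r⌋₊ / d : ℕ) : ℝ) / r)) := by
    ext r
    rw [coprimeCount_eq_tsum, ← tsum_div_const]
    refine tsum_congr fun d => ?_
    ring
  rw [hfun]
  refine tendsto_tsum_of_dominated_convergence (bound := fun d : ℕ => a * b * (1 / (d : ℝ) ^ 2))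
    (summable_one_div_sq.mul_left _) ?_ ?_
  · exact fun d => ((hfloor ha d).mul (hfloor hb d)).const_mul _
  · filter_upwards [eventually_gt_atTop 0] with r hr d
    rw [norm_mul, Real.norm_eq_abs, Real.norm_of_nonneg (by positivity)]
    calc _ ≤ 1 * (a / d * (b / d)) := by
          exact mul_le_mul (abs_moebius_le_one_real d)
            (mul_le_mul (hle ha d hr) (hle hb d hr) (by positivity) (by positivity))
            (by positivity) zero_le_one
      _ = _ := by ring

/-- Two-sided bounds for the number of coprime pairs in a large rectangle, in the form in which
they are integrated below. -/
theorem exists_coprimeCount_bounds {a b u u' : ℝ} (ha : 0 ≤ a) (hb : 0 ≤ b)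
    (hu : u < coprimeDensity * (a * b)) (hu' : coprimeDensity * (a * b) < u') :
    ∃ t₀ > 0, ∀ t, 0 < t → t ≤ t₀ →
      ENNReal.ofReal (u / t ^ 2) ≤ (coprimeCount ⌊a / t⌋₊ ⌊b / t⌋₊ : ENNReal) ∧
      (coprimeCount ⌊a / t⌋₊ ⌊b / t⌋₊ : ENNReal) ≤ ENNReal.ofReal (u' / t ^ 2) := by
  have h := (tendsto_coprimeCount ha hb).eventually (Ioo_mem_nhds hu hu')
  obtain ⟨r₀, hr₀⟩ := eventually_atTop.1 h
  refine ⟨1 / max r₀ 1, by positivity, fun t ht htt => ?_⟩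
  have hr : r₀ ≤ 1 / t := by
    rw [le_div_comm₀ ht (by positivity)] at htt
    exact (le_max_left _ _).trans htt
  obtain ⟨h1, h2⟩ := hr₀ (1 / t) hr
  have e : ∀ c : ℝ, c * (1 / t) = c / t := fun c => by ring
  rw [e, e] at h1 h2
  have hpos : (0 : ℝ) < (1 / t) ^ 2 := by positivity
  rw [lt_div_iff₀ hpos] at h1
  rw [div_lt_iff₀ hpos] at h2
  have e2 : ∀ c : ℝ, c / t ^ 2 = c * (1 / t) ^ 2 := fun c => by ring
  constructor
  · rw [← ENNReal.ofReal_natCast, e2]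
    exact ENNReal.ofReal_le_ofReal h1.le
  · rw [← ENNReal.ofReal_natCast, e2]
    exact ENNReal.ofReal_le_ofReal h2.le

end Coprime

/-! ### The linear action -/

/-- The action of a word in the linear transvections, the case `σ = id`. -/
abbrev linWord : List Bool → ℝ × ℝ → ℝ × ℝ := word (Homeomorph.refl ℝ)

/-- The classical subtractive Euclidean algorithm, the case `σ = id`. -/
noncomputable abbrev linStep : ℝ × ℝ → ℝ × ℝ := euclidStep (Homeomorph.refl ℝ)

section Linear

theorem strictMono_refl : StrictMono (Homeomorph.refl ℝ) := fun _ _ h => h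

theorem refl_zero : Homeomorph.refl ℝ 0 = 0 := rfl

theorem linWord_smul (w : List Bool) (s : ℝ) (z : ℝ × ℝ) :
    linWord w (s • z) = s • linWord w z := by
  induction w with
  | nil => rfl
  | cons b w ih =>
    rw [linWord, word, word]
    rw [linWord] at ih
    rw [ih]
    cases b <;> ext <;> simp [letter, hTransvection, vTransvection, mul_add]

theorem linWord_mono (w : List Bool) : Monotone (linWord w) := by
  intro z z' h
  induction w with
  | nil => exact h
  | cons b w ih =>
    obtain ⟨h1, h2⟩ := ih
    cases b
    · exact ⟨h1, add_le_add h1 h2⟩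
    · exact ⟨add_le_add h1 h2, h2⟩

theorem linWord_one_one (w : List Bool) :
    ∃ p : ℕ × ℕ, (0 < p.1 ∧ 0 < p.2 ∧ Nat.Coprime p.1 p.2) ∧
      linWord w (1, 1) = ((p.1 : ℝ), (p.2 : ℝ)) := by
  induction w with
  | nil => exact ⟨(1, 1), by simp, by simp [linWord, word]⟩
  | cons b w ih =>
    obtain ⟨⟨p, q⟩, ⟨hp, hq, hpq⟩, h⟩ := ih
    rw [linWord] at h
    cases b
    · refine ⟨(p, p + q), ⟨hp, by positivity, by simpa using hpq⟩, ?_⟩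
      rw [linWord, word, h]
      simp [letter, vTransvection]
    · refine ⟨(p + q, q), ⟨by positivity, hq, by simpa using hpq⟩, ?_⟩
      rw [linWord, word, h]
      simp [letter, hTransvection]

/-- The Euclidean algorithm: every coprime pair of positive integers is reached from `(1, 1)`. -/
theorem exists_linWord_one_one {p q : ℕ} (hp : 0 < p) (hq : 0 < q) (hpq : Nat.Coprime p q) :
    ∃ w, linWord w (1, 1) = ((p : ℝ), (q : ℝ)) := by
  induction hn : p + q using Nat.strong_induction_on generalizing p q with
  | _ n ih =>
    rcases lt_trichotomy p q with h | rfl | h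
    · obtain ⟨w, hw⟩ := ih (p + (q - p)) (by omega) hp (by omega)
        (by rwa [Nat.coprime_sub_self_right h.le]) rfl
      refine ⟨false :: w, ?_⟩
      rw [linWord] at hw
      rw [linWord, word, hw]
      simp [letter, vTransvection, Nat.cast_sub h.le]
    · have : p = 1 := by simpa using hpq
      exact ⟨[], by simp [linWord, word, this]⟩
    · obtain ⟨w, hw⟩ := ih (p - q + q) (by omega) (by omega) hq
        (by rwa [Nat.coprime_sub_self_left h.le]) rfl
      refine ⟨true :: w, ?_⟩
      rw [linWord] at hw
      rw [linWord, word, hw]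
      simp [letter, hTransvection, Nat.cast_sub h.le]

theorem one_one_mem_openQuadrant : ((1 : ℝ), (1 : ℝ)) ∈ openQuadrant :=
  mem_openQuadrant.2 ⟨one_pos, one_pos⟩

theorem injective_linWord_one_one : Function.Injective fun w => linWord w (1, 1) := by
  have key : ∀ w w' : List Bool, w.length ≤ w'.length →
      linWord w (1, 1) = linWord w' (1, 1) → w = w' := by
    intro w w' hlen h
    obtain ⟨u, rfl, hu⟩ := word_eq_word strictMono_refl refl_zero hlen
      one_one_mem_openQuadrant one_one_mem_openQuadrant h
    cases u with
    | nil => simp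
    | cons b u =>
      have h1 := le_word strictMono_refl refl_zero u
        (openQuadrant_subset_quadrant one_one_mem_openQuadrant)
      have h2 : (1 : ℝ) ≤ _ := h1.1
      have h3 : (1 : ℝ) ≤ _ := h1.2
      rw [word] at hu
      cases b
      · have h4 := congrArg Prod.snd hu
        simp [letter, vTransvection] at h4
        linarith
      · have h4 := congrArg Prod.fst hu
        simp [letter, hTransvection] at h4
        linarith
  intro w w' h
  rcases le_total w.length w'.length with hl | hl
  · exact key w w' hl h
  · exact (key w' w hl h.symm).symm

/-- The words correspond to the coprime pairs of positive integers through `w ↦ w (1, 1)`. -/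
theorem orbitCount_one_one (a b : ℝ) :
    orbitCount (Homeomorph.refl ℝ) (Set.Iic (a, b)) (1, 1) = coprimeCount ⌊a⌋₊ ⌊b⌋₊ := by
  classical
  choose ψ hψ hψw using linWord_one_one
  have hinj : Function.Injective ψ := fun w w' h =>
    injective_linWord_one_one (by simp only [hψw, h])
  set S := (Finset.Ioc 0 ⌊a⌋₊ ×ˢ Finset.Ioc 0 ⌊b⌋₊).filter fun p => Nat.Coprime p.1 p.2 with hS
  set G : ℕ × ℕ → ENNReal := fun p => if p ∈ S then 1 else 0 with hG
  have hterm : ∀ w, (Set.Iic (a, b)).indicator (1 : ℝ × ℝ → ENNReal) (linWord w (1, 1)) =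
      G (ψ w) := by
    intro w
    obtain ⟨h1, h2, h3⟩ := hψ w
    rw [hψw, Set.indicator_apply]
    simp only [hG, hS, Finset.mem_filter, Finset.mem_product, Finset.mem_Ioc, Set.mem_Iic,
      Prod.mk_le_mk, Pi.one_apply, Nat.le_floor_iff' h1.ne', Nat.le_floor_iff' h2.ne']
    have h3' : Nat.gcd (ψ w).1 (ψ w).2 = 1 := h3
    simp [h1, h2, h3', Nat.Coprime]
  have hsupp : Function.support G ⊆ Set.range ψ := by
    rintro ⟨p, q⟩ hp
    have hp : (p, q) ∈ S := by
      by_contra h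
      simp [hG, h] at hp
    simp only [hS, Finset.mem_filter, Finset.mem_product, Finset.mem_Ioc] at hp
    obtain ⟨w, hw⟩ := exists_linWord_one_one hp.1.1.1 hp.1.2.1 hp.2
    refine ⟨w, ?_⟩
    rw [hψw] at hw
    have h1 := congrArg Prod.fst hw
    have h2 := congrArg Prod.snd hw
    simp only [Nat.cast_inj] at h1 h2
    exact Prod.ext h1 h2
  rw [orbitCount, tsum_congr hterm, hinj.tsum_eq hsupp, tsum_eq_sum (s := S)]
  · rw [Finset.sum_congr rfl fun p hp => if_pos hp, Finset.sum_const, nsmul_one]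
    rfl
  · intro p hp
    simp [hG, hp]

theorem smul_one_one (t : ℝ) : t • ((1 : ℝ), (1 : ℝ)) = (t, t) := by simp

theorem linWord_diag_le_iff {t a b : ℝ} (ht : 0 < t) (w : List Bool) :
    linWord w (t, t) ≤ (a, b) ↔ linWord w (1, 1) ≤ (a / t, b / t) := by
  rw [← smul_one_one, linWord_smul, Prod.le_def, Prod.le_def]
  simp only [Prod.smul_fst, Prod.smul_snd, smul_eq_mul, le_div_iff₀' ht]

theorem orbitCount_diag {t a b : ℝ} (ht : 0 < t) :
    orbitCount (Homeomorph.refl ℝ) (Set.Iic (a, b)) (t, t) = coprimeCount ⌊a / t⌋₊ ⌊b / t⌋₊ := by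
  rw [← orbitCount_one_one]
  refine tsum_congr fun w => ?_
  have := linWord_diag_le_iff (a := a) (b := b) ht w
  simp only [Set.indicator_apply, Set.mem_Iic]
  exact if_congr this rfl rfl

theorem orbitCount_antitone {x y : ℝ × ℝ} (h : x ≤ y) (a b : ℝ) :
    orbitCount (Homeomorph.refl ℝ) (Set.Iic (a, b)) y ≤
      orbitCount (Homeomorph.refl ℝ) (Set.Iic (a, b)) x := by
  refine ENNReal.tsum_le_tsum fun w => ?_
  by_cases hy : word (Homeomorph.refl ℝ) w y ∈ Set.Iic (a, b)
  · have hx : word (Homeomorph.refl ℝ) w x ∈ Set.Iic (a, b) := (linWord_mono w h).trans hy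
    rw [Set.indicator_of_mem hy, Set.indicator_of_mem hx]
    rfl
  · rw [Set.indicator_of_notMem hy]
    exact zero_le

end Linear

/-! ### Visits to cones around the diagonal -/

/-- The points whose coordinates have ratio at most `s`. -/
def cone (s : ℝ) : Set (ℝ × ℝ) := {z | z.1 ≤ s * z.2 ∧ z.2 ≤ s * z.1}

/-- The nonterminating points whose orbit under the subtractive algorithm meets `D`. -/
def visits (σ : ℝ ≃ₜ ℝ) (D : Set (ℝ × ℝ)) : Set (ℝ × ℝ) :=
  {z | z ∈ nonterminating σ ∧ ∃ n, (euclidStep σ)^[n] z ∈ D}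

section Visits

variable {σ : ℝ ≃ₜ ℝ}

theorem measurableSet_cone (s : ℝ) : MeasurableSet (cone s) :=
  (measurableSet_le measurable_fst (measurable_snd.const_mul s)).inter
    (measurableSet_le measurable_snd (measurable_fst.const_mul s))

theorem visits_subset (D : Set (ℝ × ℝ)) : visits σ D ⊆ openQuadrant :=
  fun _ hz => nonterminating_subset hz.1

theorem exists_forall_iterate_fst_lt (hσ : StrictMono σ) (h0 : σ 0 = 0) {z : ℝ × ℝ}
    (hz : z ∈ nonterminating σ) {c : ℝ} (hc : 0 < c) :
    ∃ N, ∀ n, N ≤ n → ((euclidStep σ)^[n] z).1 < c := by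
  obtain ⟨N, hN⟩ := exists_iterate_fst_lt hσ h0 hz hc
  exact ⟨N, fun n hn => lt_of_le_of_lt (iterate_antitone hσ h0 hz hn).1 hN⟩

/-- Away from the vertical axis an orbit makes finitely many visits only, so the last one
exists. -/
theorem iUnion_word_lastVisits (hσ : StrictMono σ) (h0 : σ 0 = 0) {D : Set (ℝ × ℝ)} {ε : ℝ}
    (hε : 0 < ε) (hD : ∀ z ∈ D, ε ≤ z.1) :
    ⋃ w, word σ w '' lastVisits σ D = visits σ D := by
  apply Set.Subset.antisymm
  · rintro z hz
    obtain ⟨w, x, hx, rfl⟩ := Set.mem_iUnion.1 hz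
    refine ⟨word_mem_nonterminating hσ h0 w hx.1, w.length, ?_⟩
    rw [iterate_word hσ h0 w (nonterminating_subset hx.1)]
    exact hx.2.1
  · rintro z ⟨hz, hv⟩
    obtain ⟨N, hN⟩ := exists_forall_iterate_fst_lt hσ h0 hz hε
    exact mem_iUnion_word_lastVisits hz hv
      ⟨N, fun n hn hmem => (hN n hn).not_ge (hD _ hmem)⟩

/-- To bound the mass of the points visiting `C` it suffices to bound, uniformly, the mass of the
points visiting `C` away from the vertical axis. -/
theorem measure_inter_visits_le (m : Measure (ℝ × ℝ)) {A C : Set (ℝ × ℝ)} {K : ENNReal}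
    (h : ∀ ε > 0, m (A ∩ visits σ (C ∩ {z | ε ≤ z.1})) ≤ K) : m (A ∩ visits σ C) ≤ K := by
  have hsub : A ∩ visits σ C ⊆ ⋃ j : ℕ, A ∩ visits σ (C ∩ {z | 1 / ((j : ℝ) + 1) ≤ z.1}) := by
    rintro z ⟨hzA, hz, n, hn⟩
    obtain ⟨j, hj⟩ := exists_nat_one_div_lt (mem_openQuadrant.1 (hz n)).1
    exact Set.mem_iUnion.2 ⟨j, hzA, hz, n, hn, hj.le⟩
  have hmono : Monotone fun j : ℕ => A ∩ visits σ (C ∩ {z | 1 / ((j : ℝ) + 1) ≤ z.1}) := by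
    rintro i j hij z ⟨hzA, hz, n, hn, hn'⟩
    have hn' : 1 / ((i : ℝ) + 1) ≤ _ := hn'
    exact ⟨hzA, hz, n, hn, (Nat.one_div_le_one_div hij).trans hn'⟩
  refine (measure_mono hsub).trans ?_
  rw [hmono.measure_iUnion]
  exact iSup_le fun j => h _ (by positivity)

/-- If the orbit counts of `A` are at most `K` times those of `B` at the points of `C`, then the
part of `A` visiting `C` has at most `K` times the mass of `B`. -/
theorem LocallyInvariant.measure_inter_visits_le_mul (hσ : StrictMono σ) (h0 : σ 0 = 0)
    {m : Measure (ℝ × ℝ)} {R : Set (ℝ × ℝ)} (hm : LocallyInvariant σ m R) (hR : IsLowerSet R)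
    {A B C : Set (ℝ × ℝ)} (hA : MeasurableSet A) (hAR : A ⊆ R) (hB : MeasurableSet B)
    (hBR : B ⊆ R) (hC : MeasurableSet C) {K : ENNReal} (hK : K ≠ ⊤)
    (hcount : ∀ x ∈ C ∩ openQuadrant, orbitCount σ A x ≤ K * orbitCount σ B x) :
    m (A ∩ visits σ C) ≤ K * m (B ∩ openQuadrant) := by
  refine measure_inter_visits_le m fun ε hε => ?_
  set D := C ∩ {z : ℝ × ℝ | ε ≤ z.1} with hDdef
  have hD : MeasurableSet D := hC.inter (measurableSet_le measurable_const measurable_fst)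
  have hEm := measurableSet_lastVisits σ hD
  have hE := isSection_lastVisits hσ h0 D
  have hvis := iUnion_word_lastVisits hσ h0 hε (D := D) fun z hz => hz.2
  calc m (A ∩ visits σ D) = ∫⁻ x in lastVisits σ D, orbitCount σ A x ∂m := by
        rw [← hvis, hm.measure_inter_iUnion_word hσ h0 hR hE hEm hA hAR]
    _ ≤ ∫⁻ x in lastVisits σ D, K * orbitCount σ B x ∂m :=
        setLIntegral_mono' hEm fun x hx => hcount x ⟨hx.2.1.1, nonterminating_subset hx.1⟩
    _ = K * ∫⁻ x in lastVisits σ D, orbitCount σ B x ∂m := lintegral_const_mul' _ _ hK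
    _ = K * m (B ∩ visits σ D) := by
        rw [← hvis, hm.measure_inter_iUnion_word hσ h0 hR hE hEm hB hBR]
    _ ≤ K * m (B ∩ openQuadrant) := by
        gcongr
        exact visits_subset D

end Visits

section LinearVisits

theorem linStep_smul {r : ℝ} (hr : 0 < r) (z : ℝ × ℝ) : linStep (r • z) = r • linStep z := by
  have h : r * z.2 < r * z.1 ↔ z.2 < z.1 := mul_lt_mul_iff_right₀ hr
  by_cases hz : z.2 < z.1
  · ext <;> simp [linStep, euclidStep, h, hz, mul_sub]
  · ext <;> simp [linStep, euclidStep, h, hz, mul_sub]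

theorem iterate_linStep_smul {r : ℝ} (hr : 0 < r) (n : ℕ) (z : ℝ × ℝ) :
    linStep^[n] (r • z) = r • linStep^[n] z := by
  induction n generalizing z with
  | zero => rfl
  | succ n ih =>
    rw [Function.iterate_succ_apply, Function.iterate_succ_apply, linStep_smul hr, ih]

theorem smul_mem_cone_iff {r s : ℝ} (hr : 0 < r) {z : ℝ × ℝ} : r • z ∈ cone s ↔ z ∈ cone s := by
  simp only [cone, Set.mem_ofPred_eq, Prod.smul_fst, Prod.smul_snd, smul_eq_mul,
    mul_left_comm s r, mul_le_mul_iff_right₀ hr]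

theorem smul_mem_lastVisits_cone_iff {r s : ℝ} (hr : 0 < r) {z : ℝ × ℝ} :
    r • z ∈ lastVisits (Homeomorph.refl ℝ) (cone s) ↔
      z ∈ lastVisits (Homeomorph.refl ℝ) (cone s) := by
  simp only [lastVisits, nonterminating, Set.mem_ofPred_eq]
  refine and_congr (forall_congr' fun n => ?_) (and_congr (smul_mem_cone_iff hr)
    (forall_congr' fun n => not_congr ?_))
  · rw [iterate_linStep_smul hr, mem_openQuadrant, mem_openQuadrant]
    simp [hr]
  · rw [iterate_linStep_smul hr, smul_mem_cone_iff hr]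

/-- Every nonterminating orbit enters the cone of slopes between `1 / 2` and `2` at arbitrarily
small scale, namely just before it switches between horizontal and vertical steps. -/
theorem exists_iterate_mem_cone_two {z : ℝ × ℝ} (hz : z ∈ nonterminating (Homeomorph.refl ℝ))
    {t : ℝ} (ht : 0 < t) : ∃ n, linStep^[n] z ∈ cone 2 ∧ (linStep^[n] z).1 ≤ t := by
  obtain ⟨N, hN⟩ := exists_forall_iterate_fst_lt strictMono_refl refl_zero hz ht
  by_contra! hcon
  have hcone : ∀ n, N ≤ n → linStep^[n] z ∉ cone 2 := fun n hn hmem =>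
    (hN n hn).not_ge (hcon n hmem).le
  have hpos : ∀ n, 0 < (linStep^[n] z).1 ∧ 0 < (linStep^[n] z).2 := fun n =>
    mem_openQuadrant.1 (hz n)
  have hN1 := hcone N le_rfl
  rw [cone, Set.mem_ofPred_eq, not_and_or, not_le, not_le] at hN1
  rcases hN1 with h | h
  · have hrun : ∀ k, 2 * (linStep^[N] z).2 < (linStep^[N + k] z).1 ∧
        (linStep^[N + k] z).2 = (linStep^[N] z).2 := by
      intro k
      induction k with
      | zero => exact ⟨h, rfl⟩
      | succ k ih =>
        have h1 := hcone (N + (k + 1)) (by omega)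
        have hp := hpos (N + k)
        have hp' := hpos (N + (k + 1))
        have hstep : linStep^[N + (k + 1)] z =
            ((linStep^[N + k] z).1 - (linStep^[N + k] z).2, (linStep^[N + k] z).2) := by
          rw [← add_assoc, Function.iterate_succ_apply']
          exact if_pos (show (linStep^[N + k] z).2 < (linStep^[N + k] z).1 by linarith [ih.1, ih.2])
        rw [hstep] at h1 ⊢
        rw [cone, Set.mem_ofPred_eq, not_and_or, not_le, not_le] at h1
        refine ⟨?_, ih.2⟩
        simp only at h1 ⊢
        rcases h1 with h1 | h1 <;> linarith [ih.1, ih.2]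
    obtain ⟨M, hM⟩ := exists_forall_iterate_fst_lt strictMono_refl refl_zero hz
      (c := 2 * (linStep^[N] z).2) (by linarith [(hpos N).2])
    linarith [hM (N + M) (by omega), (hrun M).1]
  · have hrun : ∀ k, 2 * (linStep^[N] z).1 < (linStep^[N + k] z).2 ∧
        (linStep^[N + k] z).1 = (linStep^[N] z).1 := by
      intro k
      induction k with
      | zero => exact ⟨h, rfl⟩
      | succ k ih =>
        have h1 := hcone (N + (k + 1)) (by omega)
        have hp := hpos (N + k)
        have hp' := hpos (N + (k + 1))
        have hstep : linStep^[N + (k + 1)] z =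
            ((linStep^[N + k] z).1, (linStep^[N + k] z).2 - (linStep^[N + k] z).1) := by
          rw [← add_assoc, Function.iterate_succ_apply']
          exact if_neg (show ¬(linStep^[N + k] z).2 < (linStep^[N + k] z).1 by
            linarith [ih.1, ih.2])
        rw [hstep] at h1 ⊢
        rw [cone, Set.mem_ofPred_eq, not_and_or, not_le, not_le] at h1
        refine ⟨?_, ih.2⟩
        simp only at h1 ⊢
        rcases h1 with h1 | h1 <;> linarith [ih.1, ih.2]
    obtain ⟨M, hM⟩ := exists_forall_iterate_fst_lt strictMono_refl refl_zero hz
      (c := (linStep^[N] z).1) (hpos N).1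
    linarith [hM (N + M) (by omega), (hrun M).2]

end LinearVisits

/-! ### Lebesgue-almost every orbit returns to a narrow cone -/

section Recurrence

open Filter Topology

theorem diag_le_of_mem_cone {s : ℝ} (hs : 0 < s) {x : ℝ × ℝ} (hx : x ∈ cone s) (hs1 : 1 ≤ s)
    (hx0 : 0 ≤ x.1) : (x.1 / s, x.1 / s) ≤ x := by
  refine ⟨div_le_self hx0 hs1, ?_⟩
  rw [div_le_iff₀' hs]
  exact hx.1

theorem le_diag_of_mem_cone {s : ℝ} {x : ℝ × ℝ} (hx : x ∈ cone s) (hs1 : 1 ≤ s)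
    (hx0 : 0 ≤ x.1) : x ≤ (s * x.1, s * x.1) :=
  ⟨le_mul_of_one_le_left hx0 hs1, hx.2⟩

/-- Near the origin, the number of words sending a point of a cone into a box is at least of the
order of the inverse square of the size of the point. -/
theorem exists_le_orbitCount {a b s u : ℝ} (ha : 0 ≤ a) (hb : 0 ≤ b) (hs : 1 ≤ s)
    (hu : u < coprimeDensity * (a * b)) :
    ∃ t₀ > 0, ∀ x ∈ cone s, 0 < x.1 → x.1 ≤ t₀ →
      ENNReal.ofReal (u / (s * x.1) ^ 2) ≤
        orbitCount (Homeomorph.refl ℝ) (Set.Iic (a, b)) x := by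
  have hs0 : 0 < s := by linarith
  obtain ⟨t₀, ht₀, h⟩ := exists_coprimeCount_bounds ha hb hu (lt_add_one _)
  refine ⟨t₀ / s, by positivity, fun x hx hx0 hxt => ?_⟩
  rw [le_div_iff₀' hs0] at hxt
  refine ((h (s * x.1) (by positivity) hxt).1).trans ?_
  rw [← orbitCount_diag (by positivity)]
  exact orbitCount_antitone (le_diag_of_mem_cone hx hs hx0.le) a b

theorem exists_orbitCount_le {a b s u : ℝ} (ha : 0 ≤ a) (hb : 0 ≤ b) (hs : 1 ≤ s)
    (hu : coprimeDensity * (a * b) < u) :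
    ∃ t₀ > 0, ∀ x ∈ cone s, 0 < x.1 → x.1 ≤ t₀ →
      orbitCount (Homeomorph.refl ℝ) (Set.Iic (a, b)) x ≤
        ENNReal.ofReal (u / (x.1 / s) ^ 2) := by
  have hs0 : 0 < s := by linarith
  obtain ⟨t₀, ht₀, h⟩ := exists_coprimeCount_bounds ha hb (sub_one_lt _) hu
  refine ⟨t₀, ht₀, fun x hx hx0 hxt => ?_⟩
  refine le_trans ?_ ((h (x.1 / s) (by positivity) ((div_le_self hx0.le hs).trans hxt)).2)
  rw [← orbitCount_diag (by positivity)]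
  exact orbitCount_antitone (diag_le_of_mem_cone hs0 hx hs hx0.le) a b

theorem volume_Iic_inter_openQuadrant (a b : ℝ) :
    volume (Set.Iic (a, b) ∩ openQuadrant) = ENNReal.ofReal a * ENNReal.ofReal b := by
  have : Set.Iic (a, b) ∩ openQuadrant = Set.Ioc 0 a ×ˢ Set.Ioc 0 b := by
    ext ⟨x, y⟩
    simp only [openQuadrant, Set.mem_inter_iff, Set.mem_Iic, Prod.mk_le_mk, Set.mem_prod,
      Set.mem_Ioi, Set.mem_Ioc]
    tauto
  rw [this, Measure.volume_eq_prod, Measure.prod_prod, Real.volume_Ioc, Real.volume_Ioc, sub_zero,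
    sub_zero]

theorem volume_smul_set (r : ℝ) (A : Set (ℝ × ℝ)) :
    volume ((fun z : ℝ × ℝ => r • z) '' A) = ENNReal.ofReal (r ^ 2) * volume A := by
  have := Measure.addHaar_image_homothety (volume : Measure (ℝ × ℝ)) 0 r A
  have h2 : Module.finrank ℝ (ℝ × ℝ) = 2 := by simp
  rw [h2, abs_of_nonneg (by positivity)] at this
  rw [← this]
  congr 1
  ext; simp [AffineMap.homothety_apply]

/-- The part of a set of points whose abscissa has size comparable to `ρ`. -/
def dyadicPart (B : Set (ℝ × ℝ)) (ρ : ℝ) : Set (ℝ × ℝ) := B ∩ {z | ρ / 2 < z.1 ∧ z.1 ≤ ρ}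

theorem measurableSet_dyadicPart {B : Set (ℝ × ℝ)} (hB : MeasurableSet B) (ρ : ℝ) :
    MeasurableSet (dyadicPart B ρ) :=
  hB.inter ((measurableSet_lt measurable_const measurable_fst).inter
    (measurableSet_le measurable_fst measurable_const))

theorem volume_dyadicPart_mul {B : Set (ℝ × ℝ)} (hB : ∀ r > (0 : ℝ), ∀ z, r • z ∈ B ↔ z ∈ B)
    {r : ℝ} (hr : 0 < r) (ρ : ℝ) :
    volume (dyadicPart B (r * ρ)) = ENNReal.ofReal (r ^ 2) * volume (dyadicPart B ρ) := by
  rw [← volume_smul_set]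
  congr 1
  ext z
  constructor
  · rintro ⟨hz, h1, h2⟩
    refine ⟨r⁻¹ • z, ⟨(hB _ (inv_pos.2 hr) z).2 hz, ?_, ?_⟩, by simp [smul_smul, hr.ne']⟩
    · simp only [Prod.smul_fst, smul_eq_mul]
      rw [lt_inv_mul_iff₀ hr]
      linarith
    · simp only [Prod.smul_fst, smul_eq_mul]
      rw [inv_mul_le_iff₀ hr]
      exact h2
  · rintro ⟨y, ⟨hy, h1, h2⟩, rfl⟩
    refine ⟨(hB r hr y).2 hy, ?_, ?_⟩
    · simp only [Prod.smul_fst, smul_eq_mul]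
      have := mul_lt_mul_of_pos_left h1 hr
      linarith
    · exact mul_le_mul_of_nonneg_left h2 hr.le

/-- The last visits to a cone form a Lebesgue-null set. They are invariant under scaling, so each of
the dyadic annuli around the origin would contribute the same positive amount to the unit box. -/
theorem volume_lastVisits_cone {s : ℝ} (hs : 1 ≤ s) :
    volume (lastVisits (Homeomorph.refl ℝ) (cone s)) = 0 := by
  set B := lastVisits (Homeomorph.refl ℝ) (cone s) with hBdef
  have hBm : MeasurableSet B := measurableSet_lastVisits _ (measurableSet_cone s)
  have hBscale : ∀ r > (0 : ℝ), ∀ z, r • z ∈ B ↔ z ∈ B := fun r hr z =>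
    smul_mem_lastVisits_cone_iff hr
  have hBpos : ∀ z ∈ B, 0 < z.1 := fun z hz => (mem_openQuadrant.1 (hz.1 0)).1
  have hsec := isSection_lastVisits strictMono_refl refl_zero (cone s)
  have hs0 : 0 < s := by linarith
  set u := coprimeDensity / 2 with hudef
  have hu : 0 < u := half_pos coprimeDensity_pos
  obtain ⟨t₀, ht₀, hcount⟩ := exists_le_orbitCount (a := 1) (b := 1) (u := u) zero_le_one
    zero_le_one hs (by linarith)
  have hfin : ∫⁻ x in B, orbitCount (Homeomorph.refl ℝ) (Set.Iic (1, 1)) x ≤ 1 := by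
    rw [← (locallyInvariant_volume (Homeomorph.refl ℝ) Set.univ).measure_inter_iUnion_word
      strictMono_refl refl_zero isLowerSet_univ hsec hBm measurableSet_Iic (Set.subset_univ _)]
    calc _ ≤ volume (Set.Iic ((1 : ℝ), (1 : ℝ)) ∩ openQuadrant) := by
          refine measure_mono (Set.inter_subset_inter_right _ ?_)
          refine Set.iUnion_subset fun w => ?_
          rintro _ ⟨x, hx, rfl⟩
          exact word_mem_openQuadrant strictMono_refl refl_zero w (hsec.subset hx)
      _ = 1 := by rw [volume_Iic_inter_openQuadrant]; simp
  set P : ℕ → Set (ℝ × ℝ) := fun j => dyadicPart B ((1 / 2) ^ j * t₀) with hP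
  have hPm : ∀ j, MeasurableSet (P j) := fun j => measurableSet_dyadicPart hBm _
  have hPdisj : Pairwise (Function.onFun Disjoint P) := by
    have key : ∀ i j, i < j → Disjoint (P i) (P j) := by
      intro i j hij
      rw [Set.disjoint_left]
      rintro z ⟨-, h1, -⟩ ⟨-, -, h2⟩
      have : (1 / 2 : ℝ) ^ j ≤ (1 / 2) ^ (i + 1) :=
        pow_le_pow_of_le_one (by norm_num) (by norm_num) hij
      rw [pow_succ] at this
      nlinarith
    intro i j hij
    rcases lt_or_gt_of_ne hij with h | h
    · exact key i j h
    · exact (key j i h).symm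
  -- each annulus contributes at least the same amount
  have hpart : ∀ j, ENNReal.ofReal (u / (s * t₀) ^ 2) * volume (P 0) ≤
      ∫⁻ x in P j, orbitCount (Homeomorph.refl ℝ) (Set.Iic (1, 1)) x := by
    intro j
    set r : ℝ := (1 / 2) ^ j with hr
    have hr0 : 0 < r := by positivity
    have hr1 : r ≤ 1 := pow_le_one₀ (by norm_num) (by norm_num)
    have h1 : volume (P j) = ENNReal.ofReal (r ^ 2) * volume (P 0) := by
      simp only [hP, pow_zero, one_mul]
      exact volume_dyadicPart_mul hBscale hr0 t₀
    calc ENNReal.ofReal (u / (s * t₀) ^ 2) * volume (P 0)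
        = ENNReal.ofReal (u / (s * (r * t₀)) ^ 2) * volume (P j) := by
          rw [h1, ← mul_assoc, ← ENNReal.ofReal_mul (by positivity)]
          congr 2
          field_simp
      _ = ∫⁻ _ in P j, ENNReal.ofReal (u / (s * (r * t₀)) ^ 2) := by
          rw [setLIntegral_const]
      _ ≤ _ := by
          refine setLIntegral_mono' (hPm j) fun x hx => ?_
          have hx0 := hBpos x hx.1
          refine le_trans ?_ (hcount x hx.1.2.1 hx0 ?_)
          · apply ENNReal.ofReal_le_ofReal
            have := hx.2.2
            gcongr
          · exact hx.2.2.trans (mul_le_of_le_one_left ht₀.le hr1)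
  have hP0 : volume (P 0) = 0 := by
    by_contra hne
    have hc : ENNReal.ofReal (u / (s * t₀) ^ 2) * volume (P 0) ≠ 0 :=
      mul_ne_zero (ENNReal.ofReal_pos.2 (by positivity)).ne' hne
    have h1 : ∑' j, ∫⁻ x in P j, orbitCount (Homeomorph.refl ℝ) (Set.Iic (1, 1)) x ≤ 1 := by
      rw [← lintegral_iUnion hPm hPdisj]
      exact (lintegral_mono_set (Set.iUnion_subset fun j => Set.inter_subset_left)).trans hfin
    have h2 := (ENNReal.tsum_le_tsum hpart).trans h1
    rw [ENNReal.tsum_const_eq_top_of_ne_zero hc] at h2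
    exact absurd h2 (by simp)
  have hall : ∀ n : ℤ, volume (dyadicPart B (2 ^ (n + 1))) = 0 := by
    intro n
    have : (2 : ℝ) ^ (n + 1) = 2 ^ (n + 1) / t₀ * t₀ := by field_simp
    rw [this, volume_dyadicPart_mul hBscale (by positivity)]
    have h0 : P 0 = dyadicPart B t₀ := by simp [hP]
    rw [← h0, hP0, mul_zero]
  refine measure_mono_null (fun z hz => ?_) (measure_iUnion_null hall)
  obtain ⟨n, hn1, hn2⟩ := exists_mem_Ioc_zpow (hBpos z hz) one_lt_two
  refine Set.mem_iUnion.2 ⟨n, hz, ?_, hn2⟩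
  rw [zpow_add₀ two_ne_zero, zpow_one, mul_div_cancel_right₀ _ two_ne_zero]
  exact hn1

theorem linWord_replicate_false (k : ℕ) (z : ℝ × ℝ) :
    linWord (List.replicate k false) z = (z.1, z.2 + k * z.1) := by
  induction k with
  | zero => simp [linWord, word]
  | succ k ih =>
    rw [linWord] at ih
    rw [List.replicate_succ, linWord, word, ih]
    ext
    · simp [letter, vTransvection]
    · simp [letter, vTransvection]; ring

theorem measurePreserving_word (σ : ℝ ≃ₜ ℝ) (w : List Bool) :
    MeasurePreserving (word σ w) (volume : Measure (ℝ × ℝ)) volume := by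
  induction w with
  | nil => exact MeasurePreserving.id _
  | cons b w ih => exact (measurePreserving_letter σ b).comp ih

/-- Lebesgue-almost every nonterminating orbit visits a given cone infinitely often. A point with
finitely many visits is sent by a fixed word to a point which has in addition a first visit, hence
lies in the image of a last visit. -/
theorem volume_finite_visits_cone {s : ℝ} (hs : 1 < s) :
    volume {z | z ∈ nonterminating (Homeomorph.refl ℝ) ∧
      ∃ N, ∀ n, N ≤ n → linStep^[n] z ∉ cone s} = 0 := by
  obtain ⟨k, hk⟩ := exists_nat_ge (1 / (s - 1))
  have hs1 : 0 < s - 1 := by linarith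
  rw [div_le_iff₀ hs1] at hk
  set u := true :: List.replicate k false with hu
  have hnull : volume (⋃ w, linWord w '' lastVisits (Homeomorph.refl ℝ) (cone s)) = 0 := by
    refine measure_iUnion_null fun w => ?_
    rw [(locallyInvariant_volume _ Set.univ).measure_image_word strictMono_refl refl_zero
      isLowerSet_univ w (measurableSet_lastVisits _ (measurableSet_cone s))
      (fun x hx => openQuadrant_subset_quadrant (nonterminating_subset hx.1)) (Set.subset_univ _)]
    exact volume_lastVisits_cone hs.le
  refine measure_mono_null ?_
    ((measurePreserving_word (Homeomorph.refl ℝ) u).quasiMeasurePreserving.preimage_null hnull)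
  rintro z ⟨hz, N, hN⟩
  obtain ⟨hz1, hz2⟩ := mem_openQuadrant.1 (hz 0)
  simp only [Function.iterate_zero, id_eq] at hz1 hz2
  refine mem_iUnion_word_lastVisits (word_mem_nonterminating strictMono_refl refl_zero u hz)
    ⟨0, ?_⟩ ⟨N + u.length, fun n hn => ?_⟩
  · have hrep := linWord_replicate_false k z
    rw [linWord] at hrep
    simp only [Function.iterate_zero, id_eq, hu, word, hrep]
    refine ⟨?_, ?_⟩
    · simp only [letter, hTransvection, Homeomorph.refl_symm, Homeomorph.refl_apply, id_eq]
      nlinarith [mul_le_mul_of_nonneg_right hk hz1.le, mul_pos hs1 hz2]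
    · simp only [letter, hTransvection, Homeomorph.refl_symm, Homeomorph.refl_apply, id_eq]
      have : 0 ≤ (k : ℝ) * z.1 := by positivity
      nlinarith [mul_nonneg hs1.le this, mul_pos hs1 hz2, mul_pos hs1 hz1]
  · obtain ⟨j, rfl⟩ := Nat.exists_eq_add_of_le hn
    rw [show N + u.length + j = (N + j) + u.length by ring, Function.iterate_add_apply,
      iterate_word strictMono_refl refl_zero u (nonterminating_subset hz)]
    exact hN _ (by omega)

end Recurrence

/-! ### Uniqueness in the linear case -/

section LinearUniqueness

open Filter Topology

/-- The nonterminating points whose visits to the cone of ratio `s` all have abscissa outside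
`[l, t]`. For `l = 0` these are the points with no visit at scale `t` or below. -/
def avoiding (s l t : ℝ) : Set (ℝ × ℝ) :=
  {z | z ∈ nonterminating (Homeomorph.refl ℝ) ∧
    ∀ n, linStep^[n] z ∈ cone s → l ≤ (linStep^[n] z).1 → t < (linStep^[n] z).1}

theorem measurableSet_avoiding (s l t : ℝ) : MeasurableSet (avoiding s l t) := by
  have : avoiding s l t = nonterminating (Homeomorph.refl ℝ) ∩
      ⋂ n, linStep^[n] ⁻¹' ((cone s)ᶜ ∪ ({z | l ≤ z.1}ᶜ ∪ {z | t < z.1})) := by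
    ext z
    simp only [avoiding, Set.mem_ofPred_eq, Set.mem_inter_iff, Set.mem_iInter, Set.mem_preimage,
      Set.mem_union, Set.mem_compl_iff]
    refine and_congr_right fun _ => forall_congr' fun n => ?_
    tauto
  rw [this]
  refine (measurableSet_nonterminating _).inter (.iInter fun n => ?_)
  exact measurable_iterate_euclidStep _ n ((measurableSet_cone s).compl.union
    ((measurableSet_le measurable_const measurable_fst).compl.union
      (measurableSet_lt measurable_const measurable_fst)))

theorem volume_quadrant_diff_nonterminating (σ : ℝ ≃ₜ ℝ) (hσ : StrictMono σ) (h0 : σ 0 = 0) :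
    volume (quadrant \ nonterminating σ) = 0 := by
  have := (locallyInvariant_volume σ Set.univ).measure_diff_nonterminating hσ h0 isLowerSet_univ
    MeasurableSet.univ volume_axes
  rwa [Set.univ_inter] at this

/-- The square `[t, 2 t) × [t, 2 t)`, without the terminating points. -/
def cell (t : ℝ) : Set (ℝ × ℝ) :=
  (Set.Ico t (2 * t) ×ˢ Set.Ico t (2 * t)) ∩ nonterminating (Homeomorph.refl ℝ)

theorem measurableSet_cell (t : ℝ) : MeasurableSet (cell t) :=
  (measurableSet_Ico.prod measurableSet_Ico).inter (measurableSet_nonterminating _)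

theorem isSection_cell (t : ℝ) : IsSection (Homeomorph.refl ℝ) (cell t) where
  subset _ hx := nonterminating_subset hx.2
  word_notMem u hu x hx hux := by
    cases u with
    | nil => exact hu rfl
    | cons b u =>
      have hle := le_word strictMono_refl refl_zero u
        (openQuadrant_subset_quadrant (nonterminating_subset hx.2))
      have h1 : t ≤ x.1 := hx.1.1.1
      have h2 : t ≤ x.2 := hx.1.2.1
      have h3 := hle.1
      have h4 := hle.2
      cases b
      · have h5 : (word (Homeomorph.refl ℝ) u x).1 + (word (Homeomorph.refl ℝ) u x).2 < 2 * t :=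
          hux.1.2.2
        linarith
      · have h5 : (word (Homeomorph.refl ℝ) u x).1 + (word (Homeomorph.refl ℝ) u x).2 < 2 * t :=
          hux.1.1.2
        linarith

theorem volume_cell {t : ℝ} (ht : 0 < t) : ENNReal.ofReal (t ^ 2) ≤ volume (cell t) := by
  have h1 : volume (Set.Ico t (2 * t) ×ˢ Set.Ico t (2 * t)) = ENNReal.ofReal (t ^ 2) := by
    rw [Measure.volume_eq_prod, Measure.prod_prod, Real.volume_Ico, ← ENNReal.ofReal_mul]
    · congr 1; ring
    · linarith
  have h2 : (Set.Ico t (2 * t) ×ˢ Set.Ico t (2 * t)) ⊆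
      cell t ∪ (quadrant \ nonterminating (Homeomorph.refl ℝ)) := by
    intro z hz
    by_cases hI : z ∈ nonterminating (Homeomorph.refl ℝ)
    · exact Or.inl ⟨hz, hI⟩
    · exact Or.inr ⟨mem_quadrant.2 ⟨ht.le.trans hz.1.1, ht.le.trans hz.2.1⟩, hI⟩
  rw [← h1]
  refine (measure_mono h2).trans ((measure_union_le _ _).trans ?_)
  rw [volume_quadrant_diff_nonterminating _ strictMono_refl refl_zero, add_zero]

/-- If a word sends `x` to a point avoiding the cone of ratio `s`, then it sends every point
comparable to `x` to a point avoiding a narrower cone, down to the scale of `x`. -/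
theorem linWord_mem_avoiding {s t₀ c : ℝ} (hs : 1 < s) {x y : ℝ × ℝ} (hx : x ∈ cone 2)
    (hxQ : x ∈ openQuadrant) (hy : y ∈ cell x.1) {w : List Bool}
    (hw : linWord w x ∈ Set.Iic (c, c) ∩ avoiding s 0 t₀) :
    linWord w y ∈ Set.Iic (4 * c, 4 * c) ∩ avoiding (1 + (s - 1) / 8) (2 * x.1) (t₀ / 2) := by
  obtain ⟨hx1, hx2⟩ := mem_openQuadrant.1 hxQ
  have hyQ : y ∈ openQuadrant := nonterminating_subset hy.2
  have hy1 : x.1 ≤ y.1 ∧ y.1 < 2 * x.1 := hy.1.1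
  have hy2 : x.1 ≤ y.2 ∧ y.2 < 2 * x.1 := hy.1.2
  have hxc1 : x.1 ≤ 2 * x.2 := hx.1
  have hxc2 : x.2 ≤ 2 * x.1 := hx.2
  -- `x` and `y` are comparable, and linear words are monotone and homogeneous
  have hxy : ∀ u, linWord u x ≤ (2 : ℝ) • linWord u y := by
    intro u
    rw [← linWord_smul]
    refine linWord_mono u ⟨?_, ?_⟩ <;> simp only [Prod.smul_fst, Prod.smul_snd, smul_eq_mul] <;>
      linarith
  have hyx : ∀ u, linWord u y ≤ (4 : ℝ) • linWord u x := by
    intro u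
    rw [← linWord_smul]
    refine linWord_mono u ⟨?_, ?_⟩ <;> simp only [Prod.smul_fst, Prod.smul_snd, smul_eq_mul] <;>
      linarith
  refine ⟨(hyx w).trans ⟨?_, ?_⟩, word_mem_nonterminating strictMono_refl refl_zero w hy.2, ?_⟩
  · exact mul_le_mul_of_nonneg_left hw.1.1 (by norm_num)
  · exact mul_le_mul_of_nonneg_left hw.1.2 (by norm_num)
  intro n hn hln
  -- the visit of `y` takes place before the word is used up, as `y` has abscissa below `2 * x.1`
  have hnw : n < w.length := by
    by_contra! hle
    obtain ⟨j, rfl⟩ := Nat.exists_eq_add_of_le' hle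
    rw [linStep, linWord, Function.iterate_add_apply,
      iterate_word strictMono_refl refl_zero w hyQ] at hln
    have := (iterate_antitone strictMono_refl refl_zero hy.2 (Nat.zero_le j)).1
    simp only [Function.iterate_zero, id_eq] at this
    linarith
  obtain ⟨v, u, rfl, hv⟩ : ∃ v u, w = v ++ u ∧ v.length = n :=
    ⟨w.take n, w.drop n, (List.take_append_drop n w).symm, by simp [hnw.le]⟩
  have hity : linStep^[n] (linWord (v ++ u) y) = linWord u y := by
    rw [← hv]; exact iterate_word_append strictMono_refl refl_zero v u hyQ
  have hitx : linStep^[n] (linWord (v ++ u) x) = linWord u x := by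
    rw [← hv]; exact iterate_word_append strictMono_refl refl_zero v u hxQ
  rw [hity] at hn ⊢
  have hav := hw.2.2 n
  rw [hitx] at hav
  -- Undoing the last letter of `u` gives, for `y`, a ratio of coordinates at most `(s - 1) / 8`;
  -- the comparison with `x` costs a factor `2 * 4`.
  have hcone : linWord u x ∈ cone s := by
    cases u with
    | nil => simp at hnw; omega
    | cons b u =>
      have hpx := mem_openQuadrant.1 (word_mem_openQuadrant strictMono_refl refl_zero u hxQ)
      have h1 := hxy u
      have h2 := hyx u
      obtain ⟨h11, h12⟩ := h1
      obtain ⟨h21, h22⟩ := h2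
      simp only [Prod.smul_fst, Prod.smul_snd, smul_eq_mul] at h11 h12 h21 h22
      have hs1 : 0 < s - 1 := by linarith
      obtain ⟨hn1, hn2⟩ := hn
      cases b
      · simp only [linWord, word, letter, vTransvection, Homeomorph.refl_apply, id_eq]
          at hn1 hn2 h11 h12 h21 h22 hpx ⊢
        refine ⟨?_, ?_⟩ <;> simp only
        · nlinarith
        · nlinarith
      · simp only [linWord, word, letter, hTransvection, Homeomorph.refl_symm,
          Homeomorph.refl_apply, id_eq] at hn1 hn2 h11 h12 h21 h22 hpx ⊢
        refine ⟨?_, ?_⟩ <;> simp only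
        · nlinarith
        · nlinarith
  have h1 := hav hcone
    (mem_openQuadrant.1 (word_mem_openQuadrant strictMono_refl refl_zero u hxQ)).1.le
  have h2 := (hxy u).1
  simp only [Prod.smul_fst, smul_eq_mul] at h2
  linarith

/-- The number of words sending `x` into the avoiding part of a box is controlled by a Lebesgue
measure: the images of a cell of the size of `x` under these words are disjoint. -/
theorem orbitCount_avoiding_mul_le {s t₀ c : ℝ} (hs : 1 < s) {x : ℝ × ℝ} (hx : x ∈ cone 2)
    (hxQ : x ∈ openQuadrant) :
    orbitCount (Homeomorph.refl ℝ) (Set.Iic (c, c) ∩ avoiding s 0 t₀) x *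
        ENNReal.ofReal (x.1 ^ 2) ≤
      volume (Set.Iic (4 * c, 4 * c) ∩ avoiding (1 + (s - 1) / 8) (2 * x.1) (t₀ / 2)) := by
  set L := Set.Iic (4 * c, 4 * c) ∩ avoiding (1 + (s - 1) / 8) (2 * x.1) (t₀ / 2) with hL
  have hLm : MeasurableSet L := measurableSet_Iic.inter (measurableSet_avoiding _ _ _)
  have hSm := measurableSet_cell x.1
  have hwm : ∀ w, MeasurableSet (L ∩ linWord w '' cell x.1) := fun w =>
    hLm.inter ((measurableEmbedding_word _ w).measurableSet_image.2 hSm)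
  have hdisj := (isSection_cell x.1).pairwise_disjoint strictMono_refl refl_zero
  calc _ ≤ orbitCount (Homeomorph.refl ℝ) (Set.Iic (c, c) ∩ avoiding s 0 t₀) x *
        volume (cell x.1) := by
        gcongr
        exact volume_cell (mem_openQuadrant.1 hxQ).1
    _ ≤ ∑' w, volume (L ∩ linWord w '' cell x.1) := by
        rw [orbitCount, ← ENNReal.tsum_mul_right]
        refine ENNReal.tsum_le_tsum fun w => ?_
        by_cases hw : word (Homeomorph.refl ℝ) w x ∈ Set.Iic (c, c) ∩ avoiding s 0 t₀
        · have hsub : linWord w '' cell x.1 ⊆ L := by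
            rintro _ ⟨y, hy, rfl⟩
            exact linWord_mem_avoiding hs hx hxQ hy hw
          rw [Set.indicator_of_mem hw, Set.inter_eq_right.2 hsub, Pi.one_apply, one_mul,
            (locallyInvariant_volume _ Set.univ).measure_image_word strictMono_refl refl_zero
              isLowerSet_univ w hSm
              (fun y hy => openQuadrant_subset_quadrant (nonterminating_subset hy.2))
              (Set.subset_univ _)]
        · rw [Set.indicator_of_notMem hw, zero_mul]
          exact zero_le
    _ = volume (⋃ w, L ∩ linWord w '' cell x.1) := by
        rw [measure_iUnion _ hwm]
        exact fun w w' h => (hdisj h).mono Set.inter_subset_right Set.inter_subset_right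
    _ ≤ volume L := measure_mono (Set.iUnion_subset fun w => Set.inter_subset_left)

/-- As the lower scale tends to `0`, the Lebesgue measure of the avoiding points tends to `0`. -/
theorem tendsto_volume_avoiding {s t₀ c : ℝ} (hs : 1 < s) (ht₀ : 0 < t₀) :
    Tendsto (fun j : ℕ => volume (Set.Iic (c, c) ∩ avoiding s (1 / ((j : ℝ) + 1)) t₀)) atTop
      (𝓝 0) := by
  have hnull : volume (⋂ j : ℕ, Set.Iic (c, c) ∩ avoiding s (1 / ((j : ℝ) + 1)) t₀) = 0 := by
    refine measure_mono_null (fun z hz => ?_) (volume_finite_visits_cone hs)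
    rw [Set.mem_iInter] at hz
    have hzI := (hz 0).2.1
    obtain ⟨N, hN⟩ := exists_forall_iterate_fst_lt strictMono_refl refl_zero hzI ht₀
    refine ⟨hzI, N, fun n hn hmem => ?_⟩
    obtain ⟨j, hj⟩ := exists_nat_one_div_lt (mem_openQuadrant.1 (hzI n)).1
    exact (hN n hn).not_gt ((hz j).2.2 n hmem hj.le)
  rw [← hnull]
  refine tendsto_measure_iInter_atTop
    (fun j => (measurableSet_Iic.inter (measurableSet_avoiding _ _ _)).nullMeasurableSet) ?_
    ⟨0, ?_⟩
  · rintro i j hij z ⟨hz, hzI, h⟩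
    exact ⟨hz, hzI, fun n hn hl => h n hn ((Nat.one_div_le_one_div hij).trans hl)⟩
  · refine ((measure_mono (Set.inter_subset_inter_right _ fun z hz =>
      nonterminating_subset hz.1)).trans_lt ?_).ne
    rw [volume_Iic_inter_openQuadrant]
    exact ENNReal.mul_lt_top ENNReal.ofReal_lt_top ENNReal.ofReal_lt_top

variable {m : Measure (ℝ × ℝ)} {c : ℝ}

/-- For an invariant measure, too, almost every orbit visits a given cone at arbitrarily small
scale. Relative to the last visit to the cone of ratio `2` at a small scale, the words leading to
avoiding points form a vanishing proportion of all words leading into the box. -/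
theorem LocallyInvariant.measure_avoiding
    (hm : LocallyInvariant (Homeomorph.refl ℝ) m (Set.Iic (c, c))) (hc : 0 < c)
    (hfin : m (Set.Iic (c, c) ∩ openQuadrant) ≠ ⊤) {s t₀ : ℝ} (hs : 1 < s) (ht₀ : 0 < t₀) :
    m (Set.Iic (c, c) ∩ avoiding s 0 t₀) = 0 := by
  set A := Set.Iic (c, c) ∩ avoiding s 0 t₀ with hA
  have hAm : MeasurableSet A := measurableSet_Iic.inter (measurableSet_avoiding _ _ _)
  set u := coprimeDensity * (c * c) / 2 with hu
  have hpos : 0 < coprimeDensity * (c * c) := mul_pos coprimeDensity_pos (by positivity)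
  have hu0 : 0 < u := half_pos hpos
  obtain ⟨t₁, ht₁, hcount⟩ := exists_le_orbitCount (s := 2) (u := u) hc.le hc.le one_le_two
    (half_lt_self hpos)
  set V : ℕ → ENNReal := fun j =>
    volume (Set.Iic (4 * c, 4 * c) ∩ avoiding (1 + (s - 1) / 8) (1 / ((j : ℝ) + 1)) (t₀ / 2))
    with hV
  have hVtend : Tendsto V atTop (𝓝 0) := tendsto_volume_avoiding (by linarith) (by positivity)
  have hbound : ∀ᶠ j in atTop, m A ≤ ENNReal.ofReal (4 / u) * V j *
      m (Set.Iic (c, c) ∩ openQuadrant) := by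
    filter_upwards [hVtend.eventually_lt_const (show (0 : ENNReal) < ⊤ by simp)] with j hjfin
    set δ : ℝ := 1 / ((j : ℝ) + 1) with hδ
    have hδ0 : 0 < δ := by positivity
    set C : Set (ℝ × ℝ) := cone 2 ∩ {x | x.1 ≤ min t₁ (δ / 2)} with hC
    have hCm : MeasurableSet C :=
      (measurableSet_cone 2).inter (measurableSet_le measurable_fst measurable_const)
    have hAvis : A ⊆ A ∩ visits (Homeomorph.refl ℝ) C := by
      intro z hz
      obtain ⟨n, hn1, hn2⟩ := exists_iterate_mem_cone_two hz.2.1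
        (show 0 < min t₁ (δ / 2) by positivity)
      exact ⟨hz, hz.2.1, n, hn1, hn2⟩
    refine (measure_mono hAvis).trans (hm.measure_inter_visits_le_mul strictMono_refl refl_zero
      (isLowerSet_Iic _) hAm Set.inter_subset_left measurableSet_Iic subset_rfl hCm
      (ENNReal.mul_ne_top ENNReal.ofReal_ne_top hjfin.ne) ?_)
    rintro x ⟨⟨hx2, hxt⟩, hxQ⟩
    have hx0 : 0 < x.1 := (mem_openQuadrant.1 hxQ).1
    have hxt : x.1 ≤ min t₁ (δ / 2) := hxt
    have h1 := orbitCount_avoiding_mul_le (t₀ := t₀) (c := c) hs hx2 hxQ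
    have h2 := hcount x hx2 hx0 (hxt.trans (min_le_left _ _))
    have h3 : volume (Set.Iic (4 * c, 4 * c) ∩
        avoiding (1 + (s - 1) / 8) (2 * x.1) (t₀ / 2)) ≤ V j := by
      refine measure_mono (Set.inter_subset_inter_right _ ?_)
      rintro z ⟨hzI, h⟩
      refine ⟨hzI, fun n hn hl => h n hn (le_trans ?_ hl)⟩
      have := hxt.trans (min_le_right _ _)
      linarith
    have hsq : ENNReal.ofReal (x.1 ^ 2) * ENNReal.ofReal ((x.1 ^ 2)⁻¹) = 1 := by
      rw [← ENNReal.ofReal_mul (by positivity), mul_inv_cancel₀ (by positivity),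
        ENNReal.ofReal_one]
    calc orbitCount (Homeomorph.refl ℝ) A x
        = orbitCount (Homeomorph.refl ℝ) A x * ENNReal.ofReal (x.1 ^ 2) *
            ENNReal.ofReal ((x.1 ^ 2)⁻¹) := by rw [mul_assoc, hsq, mul_one]
      _ ≤ V j * ENNReal.ofReal ((x.1 ^ 2)⁻¹) := by
          gcongr
          exact h1.trans h3
      _ = ENNReal.ofReal (4 / u) * V j * ENNReal.ofReal (u / (2 * x.1) ^ 2) := by
          rw [mul_comm (ENNReal.ofReal (4 / u)), mul_assoc, ← ENNReal.ofReal_mul (by positivity)]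
          congr 2
          field_simp
          norm_num
      _ ≤ _ := by gcongr
  have hlim : Tendsto (fun j => ENNReal.ofReal (4 / u) * V j *
      m (Set.Iic (c, c) ∩ openQuadrant)) atTop (𝓝 0) := by
    have h1 := ENNReal.Tendsto.const_mul (a := ENNReal.ofReal (4 / u)) hVtend
      (Or.inr ENNReal.ofReal_ne_top)
    have h2 := ENNReal.Tendsto.mul_const h1 (Or.inr hfin)
    simpa using h2
  exact le_antisymm (ge_of_tendsto hlim hbound) zero_le

/-- The masses of two boxes at the origin compare like their areas: decompose both boxes over the
last visits to a narrow cone at a small scale, where the two orbit counts are nearly proportional to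
the areas. -/
theorem LocallyInvariant.measure_box_mul_le
    (hm : LocallyInvariant (Homeomorph.refl ℝ) m (Set.Iic (c, c))) (hc : 0 < c)
    (hfin : m (Set.Iic (c, c) ∩ openQuadrant) ≠ ⊤) (hax : m (quadrant \ openQuadrant) = 0)
    {a₁ b₁ a₂ b₂ : ℝ} (ha₁ : 0 < a₁) (hb₁ : 0 < b₁) (ha₂ : 0 < a₂) (hb₂ : 0 < b₂)
    (ha₁c : a₁ ≤ c) (hb₁c : b₁ ≤ c) (ha₂c : a₂ ≤ c) (hb₂c : b₂ ≤ c) :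
    m (Set.Iic (a₁, b₁) ∩ openQuadrant) ≤
      ENNReal.ofReal (a₁ * b₁ / (a₂ * b₂)) * m (Set.Iic (a₂, b₂) ∩ openQuadrant) := by
  have hsub₁ : Set.Iic (a₁, b₁) ⊆ Set.Iic (c, c) := Set.Iic_subset_Iic.2 ⟨ha₁c, hb₁c⟩
  have hsub₂ : Set.Iic (a₂, b₂) ⊆ Set.Iic (c, c) := Set.Iic_subset_Iic.2 ⟨ha₂c, hb₂c⟩
  have hκ := coprimeDensity_pos
  -- A factor `s` of error comes from each of the two counts, a factor `s ^ 4` from replacing `x` by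
  -- diagonal points on either side of it.
  have hstep : ∀ s : ℝ, 1 < s → m (Set.Iic (a₁, b₁) ∩ openQuadrant) ≤
      ENNReal.ofReal (s ^ 6 * (a₁ * b₁ / (a₂ * b₂))) * m (Set.Iic (a₂, b₂) ∩ openQuadrant) := by
    intro s hs
    have hs0 : 0 < s := by linarith
    set k₁ := coprimeDensity * (a₁ * b₁) with hk₁
    set k₂ := coprimeDensity * (a₂ * b₂) with hk₂
    have hk₁0 : 0 < k₁ := by positivity
    have hk₂0 : 0 < k₂ := by positivity
    obtain ⟨t₁, ht₁, h₁⟩ := exists_orbitCount_le (s := s) (u := s * k₁) ha₁.le hb₁.le hs.le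
      (lt_mul_of_one_lt_left hk₁0 hs)
    obtain ⟨t₂, ht₂, h₂⟩ := exists_le_orbitCount (s := s) (u := k₂ / s) ha₂.le hb₂.le hs.le
      (div_lt_self hk₂0 hs)
    set t := min t₁ t₂ with ht
    have ht0 : 0 < t := lt_min ht₁ ht₂
    set C : Set (ℝ × ℝ) := cone s ∩ {x | x.1 ≤ t} with hC
    have hCm : MeasurableSet C :=
      (measurableSet_cone s).inter (measurableSet_le measurable_fst measurable_const)
    have hnt : m ((Set.Iic (c, c) ∩ quadrant) \ nonterminating (Homeomorph.refl ℝ)) = 0 :=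
      hm.measure_diff_nonterminating strictMono_refl refl_zero (isLowerSet_Iic _)
        measurableSet_Iic hax
    have hcover : Set.Iic (a₁, b₁) ∩ openQuadrant ⊆
        (Set.Iic (a₁, b₁) ∩ visits (Homeomorph.refl ℝ) C) ∪
          (((Set.Iic (c, c) ∩ quadrant) \ nonterminating (Homeomorph.refl ℝ)) ∪
            (Set.Iic (c, c) ∩ avoiding s 0 t)) := by
      rintro z ⟨hz, hzQ⟩
      by_cases hI : z ∈ nonterminating (Homeomorph.refl ℝ)
      · by_cases hv : ∃ n, linStep^[n] z ∈ C
        · exact Or.inl ⟨hz, hI, hv⟩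
        · push Not at hv
          exact Or.inr (Or.inr ⟨hsub₁ hz, hI, fun n hn _ => not_le.1 fun hle => hv n ⟨hn, hle⟩⟩)
      · exact Or.inr (Or.inl ⟨⟨hsub₁ hz, openQuadrant_subset_quadrant hzQ⟩, hI⟩)
    have hnull := measure_union_null hnt (hm.measure_avoiding hc hfin hs ht0)
    refine (measure_mono hcover).trans ((measure_union_le _ _).trans ?_)
    rw [hnull, add_zero]
    refine hm.measure_inter_visits_le_mul strictMono_refl refl_zero (isLowerSet_Iic _)
      measurableSet_Iic hsub₁ measurableSet_Iic hsub₂ hCm ENNReal.ofReal_ne_top ?_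
    rintro x ⟨⟨hxs, hxt⟩, hxQ⟩
    have hx0 : 0 < x.1 := (mem_openQuadrant.1 hxQ).1
    have hxt : x.1 ≤ min t₁ t₂ := hxt
    refine (h₁ x hxs hx0 (hxt.trans (min_le_left _ _))).trans (le_trans (le_of_eq ?_)
      (mul_le_mul_right (h₂ x hxs hx0 (hxt.trans (min_le_right _ _))) _))
    rw [← ENNReal.ofReal_mul (by positivity)]
    congr 1
    rw [hk₁, hk₂]
    field_simp
  have hB₂ : m (Set.Iic (a₂, b₂) ∩ openQuadrant) ≠ ⊤ :=
    ne_top_of_le_ne_top hfin (measure_mono (Set.inter_subset_inter_left _ hsub₂))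
  have hlim : Tendsto (fun s : ℝ => ENNReal.ofReal (s ^ 6 * (a₁ * b₁ / (a₂ * b₂))) *
      m (Set.Iic (a₂, b₂) ∩ openQuadrant)) (𝓝[>] 1)
      (𝓝 (ENNReal.ofReal (1 ^ 6 * (a₁ * b₁ / (a₂ * b₂))) *
        m (Set.Iic (a₂, b₂) ∩ openQuadrant))) := by
    refine ENNReal.Tendsto.mul_const (ENNReal.tendsto_ofReal ?_) (Or.inr hB₂)
    have : Continuous fun s : ℝ => s ^ 6 * (a₁ * b₁ / (a₂ * b₂)) := by fun_prop
    exact (this.tendsto 1).mono_left nhdsWithin_le_nhds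
  rw [one_pow, one_mul] at hlim
  exact ge_of_tendsto hlim (eventually_mem_nhdsWithin.mono fun s hs => hstep s hs)

/-- In the linear case an invariant measure is, near the origin, a multiple of Lebesgue measure. -/
theorem LocallyInvariant.exists_restrict_eq
    (hm : LocallyInvariant (Homeomorph.refl ℝ) m (Set.Iic (c, c))) (hc : 0 < c)
    (hfin : m (Set.Iic (c, c) ∩ openQuadrant) ≠ ⊤) (hax : m (quadrant \ openQuadrant) = 0) :
    ∃ k : ENNReal, m.restrict (Set.Iic (c, c) ∩ openQuadrant) =
      k • (volume : Measure (ℝ × ℝ)).restrict (Set.Iic (c, c) ∩ openQuadrant) := by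
  set Q := Set.Iic (c, c) ∩ openQuadrant with hQ
  have hQm : MeasurableSet Q := measurableSet_Iic.inter measurableSet_openQuadrant
  set k := ENNReal.ofReal (1 / (c * c)) * m Q with hk
  have hbox : ∀ a b : ℝ, 0 < a → 0 < b → a ≤ c → b ≤ c →
      m (Set.Iic (a, b) ∩ openQuadrant) = k * volume (Set.Iic (a, b) ∩ openQuadrant) := by
    intro a b ha hb hac hbc
    rw [volume_Iic_inter_openQuadrant, ← ENNReal.ofReal_mul ha.le]
    apply le_antisymm
    · refine (hm.measure_box_mul_le hc hfin hax ha hb hc hc hac hbc le_rfl le_rfl).trans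
        (le_of_eq ?_)
      rw [hk, mul_right_comm, ← ENNReal.ofReal_mul (by positivity)]
      congr 2
      ring
    · have h := hm.measure_box_mul_le hc hfin hax hc hc ha hb le_rfl le_rfl hac hbc
      calc k * ENNReal.ofReal (a * b) = ENNReal.ofReal (a * b / (c * c)) * m Q := by
            rw [hk, mul_right_comm, ← ENNReal.ofReal_mul (by positivity)]
            congr 2
            ring
        _ ≤ ENNReal.ofReal (a * b / (c * c)) * (ENNReal.ofReal (c * c / (a * b)) *
              m (Set.Iic (a, b) ∩ openQuadrant)) := by gcongr
        _ = m (Set.Iic (a, b) ∩ openQuadrant) := by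
            rw [← mul_assoc, ← ENNReal.ofReal_mul (by positivity)]
            rw [show a * b / (c * c) * (c * c / (a * b)) = 1 by field_simp, ENNReal.ofReal_one,
              one_mul]
  refine ⟨k, ?_⟩
  have : IsFiniteMeasure (m.restrict Q) := ⟨by
    rw [Measure.restrict_apply_univ]; exact hfin.lt_top⟩
  have hIic : ∀ a b : ℝ, m (Set.Iic (a, b) ∩ Q) = k * volume (Set.Iic (a, b) ∩ Q) := by
    intro a b
    have hset : Set.Iic (a, b) ∩ Q = Set.Iic (min a c, min b c) ∩ openQuadrant := by
      rw [hQ, ← Set.inter_assoc, Set.Iic_inter_Iic]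
      rfl
    rw [hset]
    by_cases hpos : 0 < a ∧ 0 < b
    · exact hbox _ _ (lt_min hpos.1 hc) (lt_min hpos.2 hc) (min_le_right _ _) (min_le_right _ _)
    · have hempty : Set.Iic (min a c, min b c) ∩ openQuadrant = ∅ := by
        rw [Set.eq_empty_iff_forall_notMem]
        rintro z ⟨⟨h1, h2⟩, hz⟩
        obtain ⟨hz1, hz2⟩ := mem_openQuadrant.1 hz
        exact hpos ⟨hz1.trans_le (h1.trans (min_le_left _ _)),
          hz2.trans_le (h2.trans (min_le_left _ _))⟩
      simp [hempty]
  have hgen : (inferInstance : MeasurableSpace (ℝ × ℝ)) = MeasurableSpace.generateFrom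
      (Set.image2 (· ×ˢ ·) (Set.range (Set.Iic : ℝ → Set ℝ)) (Set.range Set.Iic)) := by
    have hspan : IsCountablySpanning (Set.range (Set.Iic : ℝ → Set ℝ)) :=
      ⟨fun n : ℕ => Set.Iic (n : ℝ), fun n => ⟨_, rfl⟩, by
        rw [Set.eq_univ_iff_forall]
        intro x
        obtain ⟨n, hn⟩ := exists_nat_ge x
        exact Set.mem_iUnion.2 ⟨n, hn⟩⟩
    refine (generateFrom_eq_prod ?_ ?_ hspan hspan).symm
    · exact ((borel_eq_generateFrom_Iic ℝ).symm.trans (BorelSpace.measurable_eq).symm)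
    · exact ((borel_eq_generateFrom_Iic ℝ).symm.trans (BorelSpace.measurable_eq).symm)
  refine ext_of_generate_finite _ hgen (isPiSystem_Iic.prod isPiSystem_Iic) ?_ ?_
  · rintro _ ⟨_, ⟨a, rfl⟩, _, ⟨b, rfl⟩, rfl⟩
    have h := hIic a b
    simp only [Set.Iic_prod_Iic]
    rw [Measure.restrict_apply measurableSet_Iic, Measure.smul_apply,
      Measure.restrict_apply measurableSet_Iic, smul_eq_mul, h]
  · have h := hIic c c
    rw [Measure.smul_apply, Measure.restrict_apply_univ, Measure.restrict_apply_univ, smul_eq_mul]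
    rwa [hQ, ← Set.inter_assoc, Set.inter_self] at h

end LinearUniqueness

/-! ### From the linear case to the general case -/

section Global

variable {σ : ℝ ≃ₜ ℝ} {m : Measure (ℝ × ℝ)}

/-- The change of the vertical unit that conjugates `σ`, where it is multiplication by `a`, to
the identity. -/
def verticalScale (a : ℝ) (z : ℝ × ℝ) : ℝ × ℝ := (z.1, a * z.2)

theorem measurableEmbedding_verticalScale {a : ℝ} (ha : 0 < a) :
    MeasurableEmbedding (verticalScale a) := by
  have hc : Continuous (verticalScale a) :=
    continuous_fst.prodMk (continuous_const.mul continuous_snd)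
  refine hc.measurableEmbedding ?_
  rintro ⟨x, y⟩ ⟨x', y'⟩ h
  simpa [verticalScale, ha.ne'] using h

theorem map_verticalScale_volume {a : ℝ} (ha : 0 < a) :
    (volume : Measure (ℝ × ℝ)).map (verticalScale a) = ENNReal.ofReal a⁻¹ • volume := by
  have h : verticalScale a = Prod.map id (a * ·) := rfl
  rw [h, Measure.volume_eq_prod, ← Measure.map_prod_map _ _ measurable_id (measurable_const_mul a),
    Measure.map_id, Real.map_volume_mul_left ha.ne', Measure.prod_smul_right,
    abs_of_pos (inv_pos.2 ha)]

/-- Near the origin, where `σ` is linear, an invariant measure is a multiple of Lebesgue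
measure. -/
theorem exists_eq_mul_volume_near_zero {a b : ℝ} (ha : 0 < a) (hb : 0 < b)
    (hlin : ∀ x ∈ Set.Icc (-b) b, σ x = a * x) (hm : LocallyInvariant σ m Set.univ)
    (hfin : m (Set.Icc 0 1 ×ˢ Set.Icc 0 1) ≠ ⊤) (hax : m (quadrant \ openQuadrant) = 0) :
    ∃ c > 0, ∃ d > 0, ∃ k : ENNReal, ∀ A, MeasurableSet A →
      A ⊆ Set.Iic (c, d) ∩ openQuadrant → m A = k * volume A := by
  set c := min b (min 1 a⁻¹) with hc
  have hc0 : 0 < c := by positivity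
  have hcb : c ≤ b := min_le_left _ _
  have hc1 : c ≤ 1 := (min_le_right _ _).trans (min_le_left _ _)
  have hca : a * c ≤ 1 := by
    have : c ≤ a⁻¹ := (min_le_right _ _).trans (min_le_right _ _)
    rwa [le_inv_comm₀ hc0 ha, ← one_div, le_div_iff₀ hc0] at this
  have hψ := measurableEmbedding_verticalScale ha
  set ν := m.comap (verticalScale a) with hν
  have hνA : ∀ A, ν A = m (verticalScale a '' A) := fun A => hψ.comap_apply m A
  have hQ : ∀ {z : ℝ × ℝ}, z ∈ quadrant → verticalScale a z ∈ quadrant := fun hz =>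
    mem_quadrant.2 ⟨hz.1, mul_nonneg ha.le hz.2⟩
  have hinv : LocallyInvariant (Homeomorph.refl ℝ) ν (Set.Iic (c, c)) := by
    intro e A hA hAQ hAc
    have hcomm : verticalScale a '' (letter (Homeomorph.refl ℝ) e '' A) =
        letter σ e '' (verticalScale a '' A) := by
      rw [Set.image_image, Set.image_image]
      refine Set.image_congr fun z hz => ?_
      have hzc := (le_letter strictMono_refl refl_zero e (hAQ hz)).trans (hAc ⟨z, hz, rfl⟩)
      obtain ⟨hz1, hz2⟩ := mem_quadrant.1 (hAQ hz)
      have h1 : σ z.1 = a * z.1 := hlin _ ⟨by linarith, hzc.1.trans hcb⟩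
      have h2 : σ.symm (a * z.2) = z.2 := by
        rw [← hlin z.2 ⟨by linarith, hzc.2.trans hcb⟩, Homeomorph.symm_apply_apply]
      cases e
      · simp [letter, vTransvection, verticalScale, h1, mul_add]
      · simp [letter, hTransvection, verticalScale, h2]
    rw [hνA, hνA, hcomm]
    refine hm e _ (hψ.measurableSet_image.2 hA) ?_ (Set.subset_univ _)
    rintro _ ⟨z, hz, rfl⟩
    exact hQ (hAQ hz)
  have hνfin : ν (Set.Iic (c, c) ∩ openQuadrant) ≠ ⊤ := by
    rw [hνA]
    refine ne_top_of_le_ne_top hfin (measure_mono ?_)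
    rintro _ ⟨z, ⟨⟨hz1, hz2⟩, hz⟩, rfl⟩
    obtain ⟨hp1, hp2⟩ := mem_openQuadrant.1 hz
    exact ⟨⟨hp1.le, hz1.trans hc1⟩, mul_nonneg ha.le hp2.le,
      (mul_le_mul_of_nonneg_left hz2 ha.le).trans hca⟩
  have hνax : ν (quadrant \ openQuadrant) = 0 := by
    rw [hνA]
    refine measure_mono_null ?_ hax
    rintro _ ⟨z, ⟨hz, hz'⟩, rfl⟩
    refine ⟨hQ hz, fun h => hz' ?_⟩
    obtain ⟨h1, h2⟩ := mem_openQuadrant.1 h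
    exact mem_openQuadrant.2 ⟨h1, pos_of_mul_pos_right h2 ha.le⟩
  obtain ⟨k, hk⟩ := hinv.exists_restrict_eq hc0 hνfin hνax
  refine ⟨c, hc0, a * c, by positivity, k * ENNReal.ofReal a⁻¹, fun A hA hAbox => ?_⟩
  have hsurj : verticalScale a '' (verticalScale a ⁻¹' A) = A := by
    refine Set.image_preimage_eq_of_subset fun z _ => ⟨(z.1, a⁻¹ * z.2), ?_⟩
    simp [verticalScale, ha.ne']
  have hpre : verticalScale a ⁻¹' A ⊆ Set.Iic (c, c) ∩ openQuadrant := by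
    intro z hz
    obtain ⟨⟨h1, h2⟩, h⟩ := hAbox hz
    obtain ⟨h3, h4⟩ := mem_openQuadrant.1 h
    exact ⟨⟨h1, le_of_mul_le_mul_left h2 ha⟩,
      mem_openQuadrant.2 ⟨h3, pos_of_mul_pos_right h4 ha.le⟩⟩
  have hpm : MeasurableSet (verticalScale a ⁻¹' A) := hψ.measurable hA
  have h := congrArg (fun ρ : Measure (ℝ × ℝ) => ρ (verticalScale a ⁻¹' A)) hk
  simp only [Measure.smul_apply, Measure.restrict_apply hpm, Set.inter_eq_left.2 hpre,
    smul_eq_mul] at h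
  rw [hνA, hsurj, ← Measure.map_apply hψ.measurable hA, map_verticalScale_volume ha,
    Measure.smul_apply, smul_eq_mul] at h
  rw [h, mul_assoc]

/-- Every nonterminating orbit enters any given box at the origin. -/
theorem exists_iterate_mem_box (hσ : StrictMono σ) (h0 : σ 0 = 0) {z : ℝ × ℝ}
    (hz : z ∈ nonterminating σ) {c d : ℝ} (hc : 0 < c) (hd : 0 < d) :
    ∃ n, (euclidStep σ)^[n] z ∈ Set.Iic (c, d) ∩ openQuadrant := by
  obtain ⟨n₁, h₁⟩ := exists_iterate_fst_lt hσ h0 hz hc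
  obtain ⟨n₂, h₂⟩ := exists_iterate_snd_lt hσ h0 hz hd
  refine ⟨max n₁ n₂, ⟨?_, ?_⟩, hz _⟩
  · exact (iterate_antitone hσ h0 hz (le_max_left n₁ n₂)).1.trans h₁.le
  · exact (iterate_antitone hσ h0 hz (le_max_right n₁ n₂)).2.trans h₂.le

/-- An invariant measure is determined by its restriction to a box at the origin. -/
theorem eq_mul_volume_of_near_zero (hσ : StrictMono σ) (h0 : σ 0 = 0)
    (hm : LocallyInvariant σ m Set.univ) (hax : m (quadrant \ openQuadrant) = 0) {c d : ℝ}
    (hc : 0 < c) (hd : 0 < d) {k : ENNReal} (hk : ∀ A, MeasurableSet A →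
      A ⊆ Set.Iic (c, d) ∩ openQuadrant → m A = k * volume A)
    {A : Set (ℝ × ℝ)} (hA : MeasurableSet A) (hAQ : A ⊆ quadrant) : m A = k * volume A := by
  set X := Set.Iic (c, d) ∩ openQuadrant with hX
  have hXm : MeasurableSet X := measurableSet_Iic.inter measurableSet_openQuadrant
  set W := ⋃ w, word σ w '' X with hW
  have hpiece : m.restrict W = (k • (volume : Measure (ℝ × ℝ))).restrict W := by
    rw [hW, Measure.restrict_iUnion_congr]
    intro w
    ext B hB
    have hset : B ∩ word σ w '' X = word σ w '' (X ∩ word σ w ⁻¹' B) := by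
      rw [Set.image_inter_preimage, Set.inter_comm]
    have hmeas : MeasurableSet (X ∩ word σ w ⁻¹' B) :=
      hXm.inter ((measurableEmbedding_word σ w).measurable hB)
    have hQ : X ∩ word σ w ⁻¹' B ⊆ quadrant := fun x hx => openQuadrant_subset_quadrant hx.1.2
    rw [Measure.restrict_apply hB, Measure.restrict_apply hB, hset, Measure.smul_apply,
      smul_eq_mul, hm.measure_image_word hσ h0 isLowerSet_univ w hmeas hQ (Set.subset_univ _),
      (locallyInvariant_volume σ Set.univ).measure_image_word hσ h0 isLowerSet_univ w hmeas hQ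
        (Set.subset_univ _), hk _ hmeas Set.inter_subset_left]
  have hWm : MeasurableSet W :=
    .iUnion fun w => (measurableEmbedding_word σ w).measurableSet_image.2 hXm
  have hcover : nonterminating σ ⊆ W := by
    intro z hz
    obtain ⟨n, hn⟩ := exists_iterate_mem_box hσ h0 hz hc hd
    obtain ⟨w, -, hw⟩ := exists_word_iterate σ n z
    exact Set.mem_iUnion.2 ⟨w, _, hn, hw⟩
  have hae : ∀ ρ : Measure (ℝ × ℝ), LocallyInvariant σ ρ Set.univ →
      ρ (quadrant \ openQuadrant) = 0 → ρ A = ρ.restrict W A := by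
    intro ρ hρ hρax
    have hnull := hρ.measure_diff_nonterminating hσ h0 isLowerSet_univ MeasurableSet.univ hρax
    rw [Set.univ_inter] at hnull
    have hdiff : ρ (A \ W) = 0 :=
      measure_mono_null (t := quadrant \ nonterminating σ)
        (fun z hz => ⟨hAQ hz.1, fun h => hz.2 (hcover h)⟩) hnull
    rw [Measure.restrict_apply hA, measure_inter_conull' hdiff]
  rw [hae m hm hax, hpiece, Measure.restrict_smul, Measure.smul_apply, smul_eq_mul,
    ← hae volume (locallyInvariant_volume σ _) volume_axes]

theorem volume_unit_square : volume (Set.Icc (0 : ℝ) 1 ×ˢ Set.Icc (0 : ℝ) 1) = 1 := by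
  rw [Measure.volume_eq_prod, Measure.prod_prod, Real.volume_Icc]
  simp

theorem quadrantMass_quadrantLebesgue {A : Set (ℝ × ℝ)} (hA : A ⊆ quadrant) :
    quadrantMass quadrantLebesgue A = volume A := by
  rw [quadrantMass, quadrantLebesgue,
    (MeasurableEmbedding.subtype_coe measurableSet_quadrant).comap_apply,
    Subtype.image_preimage_coe, Set.inter_eq_right.2 hA]

theorem axes_eq : quadrant \ openQuadrant =
    (({0} : Set ℝ) ×ˢ Set.Ici (0 : ℝ)) ∪ (Set.Ici (0 : ℝ) ×ˢ ({0} : Set ℝ)) := by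
  ext ⟨x, y⟩
  simp only [quadrant, openQuadrant, Set.mem_sdiff, Set.mem_prod, Set.mem_Ici, Set.mem_Ioi,
    Set.mem_union, Set.mem_singleton_iff, not_and_or, not_lt]
  constructor
  · rintro ⟨⟨hx, hy⟩, h | h⟩
    · exact Or.inl ⟨le_antisymm h hx, hy⟩
    · exact Or.inr ⟨hx, le_antisymm h hy⟩
  · rintro (⟨rfl, hy⟩ | ⟨hx, rfl⟩)
    · exact ⟨⟨le_rfl, hy⟩, Or.inl le_rfl⟩
    · exact ⟨⟨hx, le_rfl⟩, Or.inr le_rfl⟩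

end Global

theorem mainTheorem3 (σ : ℝ ≃ₜ ℝ) (hσ : StrictMono σ) (hodd : Function.Odd σ)
    (a b : ℝ) (ha : 0 < a) (hb : 0 < b) (hlin : ∀ x ∈ Set.Icc (-b) b, σ x = a * x)
    (μ : Measure quadrant) :
    (quadrantMass μ (Set.Icc 0 1 ×ˢ Set.Icc 0 1) = 1 ∧
      quadrantMass μ ({0} ×ˢ Set.Ici 0) = 0 ∧
      quadrantMass μ (Set.Ici 0 ×ˢ {0}) = 0 ∧
      ∀ A : Set (ℝ × ℝ), MeasurableSet A → A ⊆ quadrant →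
        quadrantMass μ A = quadrantMass μ (hTransvection σ '' A) ∧
        quadrantMass μ A = quadrantMass μ (vTransvection σ '' A)) ↔
      μ = quadrantLebesgue := by
  have h0 : σ 0 = 0 := by simpa using hlin 0 ⟨by linarith, hb.le⟩
  have hunit : Set.Icc (0 : ℝ) 1 ×ˢ Set.Icc (0 : ℝ) 1 ⊆ quadrant := fun z hz =>
    ⟨hz.1.1, hz.2.1⟩
  have hunitm : MeasurableSet (Set.Icc (0 : ℝ) 1 ×ˢ Set.Icc (0 : ℝ) 1) :=
    measurableSet_Icc.prod measurableSet_Icc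
  have hval := MeasurableEmbedding.subtype_coe measurableSet_quadrant
  constructor
  · rintro ⟨h1, hy, hx, hinv⟩
    set m := μ.map Subtype.val with hm
    have hmA : ∀ A, m A = quadrantMass μ A := fun A => hval.map_apply μ A
    have hminv : LocallyInvariant σ m Set.univ := by
      intro e A hA hAQ _
      rw [hmA, hmA]
      cases e
      · exact (hinv A hA hAQ).2.symm
      · exact (hinv A hA hAQ).1.symm
    have hax : m (quadrant \ openQuadrant) = 0 := by
      rw [axes_eq]
      exact measure_union_null ((hmA _).trans hy) ((hmA _).trans hx)
    have hm1 : m (Set.Icc 0 1 ×ˢ Set.Icc 0 1) = 1 := (hmA _).trans h1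
    obtain ⟨c, hc, d, hd, k, hk⟩ := exists_eq_mul_volume_near_zero ha hb hlin hminv
      (by rw [hm1]; exact ENNReal.one_ne_top) hax
    have hglobal := fun {A} => eq_mul_volume_of_near_zero hσ h0 hminv hax hc hd hk (A := A)
    have hk1 : k = 1 := by
      have := hglobal hunitm hunit
      rwa [hm1, volume_unit_square, mul_one, eq_comm] at this
    ext s hs
    have hsm : MeasurableSet (Subtype.val '' s : Set (ℝ × ℝ)) := hval.measurableSet_image.2 hs
    have hsQ : (Subtype.val '' s : Set (ℝ × ℝ)) ⊆ quadrant := by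
      rintro _ ⟨z, -, rfl⟩
      exact z.2
    have hs' : (Subtype.val : quadrant → ℝ × ℝ) ⁻¹' (Subtype.val '' s) = s :=
      Set.preimage_image_eq s Subtype.val_injective
    have h2 := hglobal hsm hsQ
    have h3 := quadrantMass_quadrantLebesgue hsQ
    rw [hmA, hk1, one_mul, ← h3, quadrantMass, quadrantMass, hs'] at h2
    exact h2
  · rintro rfl
    have hax := volume_axes
    rw [axes_eq, measure_union_null_iff] at hax
    refine ⟨?_, ?_, ?_, fun A hA hAQ => ⟨?_, ?_⟩⟩
    · rw [quadrantMass_quadrantLebesgue hunit, volume_unit_square]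
    · rw [quadrantMass_quadrantLebesgue, hax.1]
      exact Set.prod_mono (Set.singleton_subset_iff.2 Set.self_mem_Ici) subset_rfl
    · rw [quadrantMass_quadrantLebesgue, hax.2]
      exact Set.prod_mono subset_rfl (Set.singleton_subset_iff.2 Set.self_mem_Ici)
    · rw [quadrantMass_quadrantLebesgue hAQ, quadrantMass_quadrantLebesgue
        ((hTransvection_mapsTo σ hσ hodd).mono_left hAQ).image_subset]
      exact (locallyInvariant_volume σ Set.univ true A hA hAQ (Set.subset_univ _)).symm
    · rw [quadrantMass_quadrantLebesgue hAQ, quadrantMass_quadrantLebesgue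
        ((vTransvection_mapsTo σ hσ hodd).mono_left hAQ).image_subset]
      exact (locallyInvariant_volume σ Set.univ false A hA hAQ (Set.subset_univ _)).symm
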